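/- Let $\mathbb{H}=\{\tau\in\mathbb{C}:\operatorname{Im}\tau>0\}$, let $q=e^{2\pi i\tau}$, and let $$\Delta(\tau)=q\prod_{n=1}^{\infty}(1-q^n)^{24},\qquad E_4(\tau)=1+240\sum_{n=1}^{\infty}\Big(\sum_{d\mid n}d^3\Big)q^n,\qquad j=\frac{E_4^3}{\Delta}=\frac1q+744+\cdots$$ be the modular discriminant, the normalized Eisenstein series of weight $4$ and the $j$-invariant. Let $g_\infty\colon\mathbb{H}\to\mathbb{R}$ be the hyperbolic Green function $$g_\infty(\tau)=-\log\big((4\pi\operatorname{Im}\tau)^6\,|\Delta(\tau)|\big).$$ There is a unique function $g_{\mathrm{hyp}}\colon\mathbb{C}\to\mathbb{R}$ such that $g_\infty=g_{\mathrm{hyp}}\circ j$. Writing $\zeta=x+iy$, the partial derivative $\partial_x g_{\mathrm{hyp}}(1)$ exists and satisfies $0<\partial_x g_{\mathrm{hyp}}(1)<1$, and the function $g_1\colon\mathbb{C}\setminus\{0\}\to\mathbb{R}$ defined by $$g_1(\zeta)=g_{\mathrm{hyp}}(\zeta)-\partial_x g_{\mathrm{hyp}}(1)\cdot\log|\zeta|$$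 attains its minimum value at, and only at, $\zeta=1$. -/

import Mathlib

open scoped UpperHalfPlane

noncomputable section

/-- The `j`-invariant `j = E₄³ / Δ` on the upper half-plane, so that `j = 1/q + 744 + ⋯` with
`q = exp (2πiτ)`.  Here `E₄` has constant term `1`, and
`Δ = q ∏ (1 - qⁿ) ^ 24` (this product formula is `ModularForm.discriminant_eq_q_prod`). -/
def jInv (τ : ℍ) : ℂ := ModularForm.E₄ τ ^ 3 / ModularForm.discriminant τ

/-- The hyperbolic Green function `g_∞(τ) = -log ((4π Im τ)⁶ |Δ(τ)|)`. -/
def gInfty (τ : ℍ) : ℝ :=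
  -Real.log ((4 * Real.pi * τ.im) ^ 6 * ‖ModularForm.discriminant τ‖)

/-- `g₁(ζ) = g(ζ) - ∂ₓg(1) · log |ζ|`, where `∂ₓg(1)` is the derivative of `g` at the point `1`
in the real direction. -/
def gOne (g : ℂ → ℝ) (ζ : ℂ) : ℝ := g ζ - lineDeriv ℝ g 1 1 * Real.log ‖ζ‖

end

/-!
The function `j` is onto `ℂ` by Liouville's theorem, and it separates `SL(2, ℤ)`-orbits: the values
it takes on two different orbits form a bounded open set whose frontier consists of critical values
of `j`, hence is countable, which forces the set to be empty. As `g_∞` is `SL(2, ℤ)`-invariant, it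
factors uniquely through `j`.

The value `1` is tiny on the natural scale of `j` at `ρ = e^(2πi/3)`. In the disc coordinate `w`
centred at `ρ`, symmetry under the stabiliser of order three makes `Δ` and `E₄ / w`, freed of their
automorphy factors, functions of `s = w ^ 3` with real Taylor coefficients. Hence
`j = c * s * exp (3 e(s) - δ(s))` and `g_∞ = g_∞(ρ) - 6 log (1 - |w|²) - Re δ(s)`, where
`c ≥ 198000` and `e`, `δ` are holomorphic, vanish at `0` and are controlled by Cauchy estimates.
In particular `j = 1` at a real `r₀ ≤ 0.0175`, and `∂ₓ g_hyp(1)` is a quotient of two explicit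
logarithmic derivatives at `r₀`.

Near `ρ`, `g₁ ∘ j` is a radial function of `|w|` with a strict minimum at `r₀`, plus an angular term
that is at least a positive multiple of `|s| - Re s`. The rest of the fundamental domain lies so
high that `q`-expansions bound `g₁ ∘ j` from below by more than `g₁(1)`.
-/

open scoped UpperHalfPlane MatrixGroups Manifold Modular Topology ComplexConjugate
open Filter Metric ModularForm Set UpperHalfPlane

section Topology

lemma eq_empty_of_isOpen_of_isBounded_of_countable_frontier {E : Type*} [NormedAddCommGroup E]
    [NormedSpace ℝ E] (hrank : 1 < Module.rank ℝ E) {U : Set E} (hU : IsOpen U)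
    (hbdd : Bornology.IsBounded U) (hfr : (frontier U).Countable) : U = ∅ := by
  have : Nontrivial E := rank_pos_iff_nontrivial.mp (zero_lt_one.trans hrank)
  by_contra hne
  have hdense : Dense (frontier U)ᶜ := hfr.dense_compl ℝ
  have hsub : (frontier U)ᶜ ⊆ U := by
    refine (hfr.isPathConnected_compl_of_one_lt_rank hrank).isConnected.isPreconnected
      |>.subset_of_closure_inter_subset hU ?_ ?_
    · obtain ⟨z, hzU, hz⟩ := hdense.inter_open_nonempty U hU (nonempty_iff_ne_empty.mpr hne)
      exact ⟨z, hz, hzU⟩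
    · rintro z ⟨hz, hzfr⟩
      by_contra hzU
      exact hzfr ⟨hz, by rwa [hU.interior_eq]⟩
  refine NormedSpace.unbounded_univ ℝ E (hbdd.closure.subset ?_)
  rw [← hdense.closure_eq]
  exact closure_mono hsub

lemma exists_injOn_of_hasStrictDerivAt {𝕜 : Type*} [NontriviallyNormedField 𝕜] [CompleteSpace 𝕜]
    {f : 𝕜 → 𝕜} {f' a : 𝕜} (hf : HasStrictDerivAt f f' a) (hf' : f' ≠ 0) :
    ∃ U ∈ 𝓝 a, InjOn f U :=
  ⟨_, hf.eventually_left_inverse hf', fun _ hx _ hy h ↦ by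
    rw [← mem_ofPred.mp hx, ← mem_ofPred.mp hy, h]⟩

end Topology

section ModularInvariance

lemma discriminant_smul (γ : SL(2, ℤ)) (τ : ℍ) :
    discriminant (γ • τ) = denom γ τ ^ 12 * discriminant τ := by
  simpa using SlashInvariantForm.slash_action_eqn'' CuspForm.discriminant
    (γ := (γ : GL (Fin 2) ℝ)) (MonoidHom.mem_range.mpr ⟨γ, rfl⟩) τ

lemma E₄_smul (γ : SL(2, ℤ)) (τ : ℍ) : E₄ (γ • τ) = denom γ τ ^ 4 * E₄ τ := by
  simpa using SlashInvariantForm.slash_action_eqn'' E₄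
    (γ := (γ : GL (Fin 2) ℝ)) (MonoidHom.mem_range.mpr ⟨γ, rfl⟩) τ

lemma jInv_smul (γ : SL(2, ℤ)) (τ : ℍ) : jInv (γ • τ) = jInv τ := by
  have hdenom := denom_ne_zero γ τ
  have hΔ := discriminant_ne_zero τ
  rw [jInv, jInv, discriminant_smul, E₄_smul]
  field_simp

lemma gInfty_smul (γ : SL(2, ℤ)) (τ : ℍ) : gInfty (γ • τ) = gInfty τ := by
  have hdenom : ‖denom γ τ‖ ≠ 0 := norm_ne_zero_iff.mpr (denom_ne_zero γ τ)
  rw [gInfty, gInfty, discriminant_smul, ModularGroup.im_smul_eq_div_normSq, norm_mul, norm_pow,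
    Complex.normSq_eq_norm_sq]
  congr 2
  field_simp

lemma mdifferentiable_discriminant : MDiff discriminant := CuspForm.discriminant.holo'

lemma mdifferentiable_E₄ : MDiff E₄ := E₄.holo'

lemma differentiableOn_jInv : DifferentiableOn ℂ (jInv ∘ ofComplex) upperHalfPlaneSet :=
  ((UpperHalfPlane.mdifferentiable_iff.mp mdifferentiable_E₄).pow 3).div
    (UpperHalfPlane.mdifferentiable_iff.mp mdifferentiable_discriminant)
    fun _ _ ↦ discriminant_ne_zero _

lemma analyticOnNhd_jInv : AnalyticOnNhd ℂ (jInv ∘ ofComplex) upperHalfPlaneSet :=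
  differentiableOn_jInv.analyticOnNhd isOpen_upperHalfPlaneSet

lemma continuous_jInv : Continuous jInv :=
  (UpperHalfPlane.mdifferentiable_iff.mpr differentiableOn_jInv).continuous

lemma isPreconnected_upperHalfPlaneSet : IsPreconnected upperHalfPlaneSet :=
  (convex_halfSpace_im_gt 0).isPreconnected

lemma exists_eq_const_of_smul_invariant {f : ℍ → ℂ} (hf : MDiff f)
    (hinv : ∀ (γ : SL(2, ℤ)) τ, f (γ • τ) = f τ) (hbdd : IsBoundedAtImInfty f) :
    ∃ c, f = Function.const ℍ c := by
  have hslash (γ : SL(2, ℤ)) : f ∣[(0 : ℤ)] γ = f := by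
    ext τ
    rw [ModularForm.SL_slash_apply, hinv]
    simp
  let F : ModularForm 𝒮ℒ 0 :=
    { toFun := f
      slash_action_eq' := by
        rintro _ ⟨γ, rfl⟩
        exact hslash γ
      holo' := hf
      bdd_at_cusps' := fun {x} hx ↦ by
        rw [Subgroup.IsArithmetic.isCusp_iff_isCusp_SL2Z] at hx
        rw [OnePoint.isBoundedAt_iff_forall_SL2Z hx]
        intro γ _
        rwa [hslash γ] }
  exact ModularFormClass.levelOne_weight_zero_const F

end ModularInvariance

section Cusp

lemma cuspFunction_E₄_zero : cuspFunction 1 E₄ 0 = 1 := by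
  simpa [qExpansion_coeff] using
    EisensteinSeries.E_qExpansion_coeff_zero (k := 4) (by norm_num) ⟨2, rfl⟩

lemma analyticAt_cuspFunction_E₄ : AnalyticAt ℂ (cuspFunction 1 E₄) 0 :=
  ModularFormClass.analyticAt_cuspFunction_zero E₄ one_pos one_mem_strictPeriods_SL

lemma cuspFunction_E₄_qParam (τ : ℍ) :
    cuspFunction 1 E₄ (Function.Periodic.qParam 1 τ) = E₄ τ :=
  SlashInvariantFormClass.eq_cuspFunction E₄ τ one_mem_strictPeriods_SL one_ne_zero

lemma cuspFunction_discriminant_qParam (τ : ℍ) :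
    cuspFunction 1 discriminant (Function.Periodic.qParam 1 τ) = discriminant τ :=
  SlashInvariantFormClass.eq_cuspFunction CuspForm.discriminant τ one_mem_strictPeriods_SL
    one_ne_zero

lemma tendsto_E₄_atImInfty : Tendsto E₄ atImInfty (𝓝 1) := by
  have h := analyticAt_cuspFunction_E₄.continuousAt.tendsto.comp
    (qParam_tendsto_atImInfty one_pos)
  rw [cuspFunction_E₄_zero] at h
  exact h.congr cuspFunction_E₄_qParam

lemma tendsto_inv_jInv_atImInfty : Tendsto (fun τ ↦ (jInv τ)⁻¹) atImInfty (𝓝 0) := by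
  have hΔ : Tendsto discriminant atImInfty (𝓝 0) := discriminant_isZeroAtImInfty
  simpa [jInv, Pi.div_def] using hΔ.div (tendsto_E₄_atImInfty.pow 3) (by norm_num)

lemma tendsto_norm_jInv_atImInfty : Tendsto (fun τ ↦ ‖jInv τ‖) atImInfty atTop := by
  have h : Tendsto (fun τ ↦ (jInv τ)⁻¹) atImInfty (𝓝[≠] 0) := by
    refine tendsto_nhdsWithin_iff.mpr ⟨tendsto_inv_jInv_atImInfty, ?_⟩
    filter_upwards [tendsto_E₄_atImInfty.eventually_ne one_ne_zero] with τ hτ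
    exact inv_ne_zero (div_ne_zero (pow_ne_zero 3 hτ) (discriminant_ne_zero τ))
  simpa [Function.comp_def] using tendsto_norm_inv_nhdsNE_zero_atTop.comp h

lemma hasStrictDerivAt_discriminant_div_E₄_pow_three :
    HasStrictDerivAt (fun q ↦ cuspFunction 1 discriminant q / cuspFunction 1 E₄ q ^ 3) 1 0 := by
  have hΔ : AnalyticAt ℂ (cuspFunction 1 discriminant) 0 :=
    ModularFormClass.analyticAt_cuspFunction_zero CuspForm.discriminant one_pos
      one_mem_strictPeriods_SL
  have hΔ0 : cuspFunction 1 discriminant 0 = 0 :=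
    CuspFormClass.cuspFunction_apply_zero CuspForm.discriminant one_pos one_mem_strictPeriods_SL
  have hΔ' : deriv (cuspFunction 1 discriminant) 0 = 1 := by
    simpa [qExpansion_coeff] using discriminant_qExpansion_coeff_one
  simpa [cuspFunction_E₄_zero, hΔ0, hΔ'] using
    hΔ.hasStrictDerivAt.fun_div (analyticAt_cuspFunction_E₄.hasStrictDerivAt.fun_pow 3)
      (by simp [cuspFunction_E₄_zero])

lemma exists_smul_eq_of_qParam_eq {τ₁ τ₂ : ℍ}
    (h : Function.Periodic.qParam 1 (τ₁ : ℂ) = Function.Periodic.qParam 1 τ₂) :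
    ∃ γ : SL(2, ℤ), γ • τ₁ = τ₂ := by
  rw [Function.Periodic.qParam, Function.Periodic.qParam, Complex.exp_eq_exp_iff_exists_int] at h
  obtain ⟨n, hn⟩ := h
  refine ⟨ModularGroup.T ^ (-n), UpperHalfPlane.ext ?_⟩
  rw [ModularGroup.coe_T_zpow_smul_eq]
  have := Complex.two_pi_I_ne_zero
  field_simp at hn
  push_cast at hn ⊢
  rw [hn]
  ring

-- `1/j = q + O(q²)` is injective in `q` near `q = 0`.
lemma exists_smul_eq_of_jInv_eq_of_lt_im :
    ∃ Y : ℝ, ∀ τ₁ τ₂ : ℍ, Y < τ₁.im → Y < τ₂.im → jInv τ₁ = jInv τ₂ →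
      ∃ γ : SL(2, ℤ), γ • τ₁ = τ₂ := by
  obtain ⟨U, hU, hinj⟩ := exists_injOn_of_hasStrictDerivAt
    hasStrictDerivAt_discriminant_div_E₄_pow_three one_ne_zero
  obtain ⟨Y, hY⟩ := (atImInfty_mem _).mp ((qParam_tendsto_atImInfty one_pos).eventually hU)
  refine ⟨Y, fun τ₁ τ₂ h₁ h₂ hj ↦
    exists_smul_eq_of_qParam_eq (hinj (hY τ₁ h₁.le) (hY τ₂ h₂.le) ?_)⟩
  simp only [cuspFunction_E₄_qParam, cuspFunction_discriminant_qParam]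
  rw [← inv_div (E₄ τ₁ ^ 3), ← inv_div (E₄ τ₂ ^ 3)]
  exact congrArg (·⁻¹) hj

end Cusp

section Bijectivity

lemma jInv_surjective : Function.Surjective jInv := by
  intro c
  by_contra! hc
  have hne (τ : ℍ) : jInv τ - c ≠ 0 := sub_ne_zero.mpr (hc τ)
  have hlim : Tendsto (fun τ ↦ (jInv τ - c)⁻¹) atImInfty (𝓝 0) :=
    tendsto_inv₀_cobounded.comp <| tendsto_norm_atTop_iff_cobounded.mp <|
      tendsto_atTop_mono (fun τ ↦ norm_sub_norm_le (jInv τ) c)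
        (tendsto_atTop_add_const_right _ (-‖c‖) tendsto_norm_jInv_atImInfty)
  obtain ⟨d, hd⟩ := exists_eq_const_of_smul_invariant (f := fun τ ↦ (jInv τ - c)⁻¹)
    (UpperHalfPlane.mdifferentiable_iff.mpr
      ((differentiableOn_jInv.sub_const c).inv fun _ _ ↦ hne _))
    (fun γ τ ↦ by rw [jInv_smul]) (hlim.isBigO_one ℝ)
  have hd0 : d = 0 := tendsto_nhds_unique tendsto_const_nhds (hd ▸ hlim)
  exact inv_ne_zero (hne I) ((congrFun hd I).trans hd0)

lemma isOpenMap_jInv : IsOpenMap jInv := by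
  intro U hU
  rcases analyticOnNhd_jInv.is_constant_or_isOpen isPreconnected_upperHalfPlaneSet
    with ⟨w, hw⟩ | hopen
  · obtain ⟨τ, hτ⟩ := jInv_surjective (w + 1)
    simpa [hτ] using hw τ τ.im_pos
  · simpa [image_image] using hopen (UpperHalfPlane.coe '' U)
      (by rintro _ ⟨τ, -, rfl⟩; exact τ.im_pos) (isOpenEmbedding_coe.isOpenMap U hU)

lemma countable_setOf_deriv_jInv_eq_zero :
    {τ : ℍ | deriv (jInv ∘ ofComplex) τ = 0}.Countable := by
  suffices hdisc : DiscreteTopology {z : ℂ | 0 < z.im ∧ deriv (jInv ∘ ofComplex) z = 0} by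
    have hcount : {z : ℂ | 0 < z.im ∧ deriv (jInv ∘ ofComplex) z = 0}.Countable :=
      countable_coe_iff.mp countable_of_Lindelof_of_discrete
    refine (hcount.preimage UpperHalfPlane.coe_injective).mono fun τ hτ ↦ ?_
    exact ⟨τ.im_pos, hτ⟩
  rw [discreteTopology_subtype_iff]
  rintro z ⟨hz, -⟩
  rw [← Filter.empty_mem_iff_bot, Filter.mem_inf_principal]
  by_contra haccum
  have hfreq : ∃ᶠ x in 𝓝[≠] z, deriv (jInv ∘ ofComplex) x = 0 := fun h ↦ haccum <| by
    filter_upwards [h] with x hx hx'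
    exact hx hx'.2
  have hzero := analyticOnNhd_jInv.deriv.eqOn_zero_of_preconnected_of_frequently_eq_zero
    isPreconnected_upperHalfPlaneSet hz hfreq
  obtain ⟨a, ha⟩ := jInv_surjective 0
  obtain ⟨b, hb⟩ := jInv_surjective 1
  simpa [ha, hb] using isOpen_upperHalfPlaneSet.is_const_of_deriv_eq_zero
    isPreconnected_upperHalfPlaneSet differentiableOn_jInv hzero a.im_pos b.im_pos

lemma exists_injOn_jInv {τ : ℍ} (h : deriv (jInv ∘ ofComplex) τ ≠ 0) :
    ∃ U ∈ 𝓝 τ, InjOn jInv U := by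
  obtain ⟨U, hU, hinj⟩ :=
    exists_injOn_of_hasStrictDerivAt (analyticOnNhd_jInv τ τ.im_pos).hasStrictDerivAt h
  refine ⟨UpperHalfPlane.coe ⁻¹' U, continuous_coe.continuousAt.preimage_mem_nhds hU, ?_⟩
  exact fun x hx y hy hxy ↦ UpperHalfPlane.ext (hinj hx hy (by simpa using hxy))

lemma deriv_jInv_eq_zero_of_tendsto {x y : ℕ → ℍ} {a : ℍ} {γ : SL(2, ℤ)}
    (hx : Tendsto x atTop (𝓝 a)) (hy : Tendsto y atTop (𝓝 (γ • a)))
    (hxy : ∀ n, jInv (x n) = jInv (y n)) (hne : ∀ n (γ : SL(2, ℤ)), γ • x n ≠ y n) :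
    deriv (jInv ∘ ofComplex) a = 0 := by
  by_contra hcrit
  obtain ⟨U, hU, hinj⟩ := exists_injOn_jInv hcrit
  have hy' : Tendsto (fun n ↦ γ⁻¹ • y n) atTop (𝓝 a) := by
    have hcont : Continuous fun τ : ℍ ↦ γ⁻¹ • τ :=
      continuous_const_smul ((γ⁻¹ : SL(2, ℤ)) : GL (Fin 2) ℝ)
    have h := (hcont.tendsto (γ • a)).comp hy
    rwa [inv_smul_smul] at h
  obtain ⟨n, hxn, hyn⟩ := ((hx.eventually hU).and (hy'.eventually hU)).exists
  exact hne n γ (eq_inv_smul_iff.mp (hinj hxn hyn (by rw [jInv_smul, hxy])))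

/-- The values that `j` attains at two points inequivalent under `SL(2, ℤ)`. -/
def jInvMultipleValues : Set ℂ :=
  {c | ∃ τ₁ τ₂, jInv τ₁ = c ∧ jInv τ₂ = c ∧ ∀ γ : SL(2, ℤ), γ • τ₁ ≠ τ₂}

lemma exists_mem_fd_of_mem_jInvMultipleValues {c : ℂ} (hc : c ∈ jInvMultipleValues) :
    ∃ τ₁ ∈ 𝒟, ∃ τ₂ ∈ 𝒟, jInv τ₁ = c ∧ jInv τ₂ = c ∧ ∀ γ : SL(2, ℤ), γ • τ₁ ≠ τ₂ := by
  obtain ⟨τ₁, τ₂, h₁, h₂, hne⟩ := hc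
  obtain ⟨γ₁, hγ₁⟩ := ModularGroup.exists_smul_mem_fd τ₁
  obtain ⟨γ₂, hγ₂⟩ := ModularGroup.exists_smul_mem_fd τ₂
  refine ⟨_, hγ₁, _, hγ₂, by rw [jInv_smul, h₁], by rw [jInv_smul, h₂], fun γ hγ ↦ ?_⟩
  exact hne (γ₂⁻¹ * (γ * γ₁)) (by rw [mul_smul, mul_smul, hγ, inv_smul_smul])

lemma exists_smul_eq_iff_quotientMk_eq {x y : ℍ} :
    (∃ γ : SL(2, ℤ), γ • x = y) ↔
      (Quotient.mk _ x : Quotient (MulAction.orbitRel 𝒮ℒ ℍ)) = Quotient.mk _ y := by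
  rw [Quotient.eq, MulAction.orbitRel_apply, ← MulAction.mem_orbit_symm]
  exact ⟨fun ⟨γ, hγ⟩ ↦ ⟨⟨_, ⟨γ, rfl⟩⟩, hγ⟩, fun ⟨⟨_, ⟨γ, rfl⟩⟩, hγ⟩ ↦ ⟨γ, hγ⟩⟩

-- The action is properly discontinuous: inequivalent points have inequivalent neighbourhoods.
lemma isOpen_jInvMultipleValues : IsOpen jInvMultipleValues := by
  rw [isOpen_iff_mem_nhds]
  rintro c ⟨τ₁, τ₂, h₁, h₂, hne⟩
  let p : ℍ → Quotient (MulAction.orbitRel 𝒮ℒ ℍ) := Quotient.mk _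
  have hp : Continuous p := continuous_quotient_mk'
  obtain ⟨U, V, hU, hV, hτ₁, hτ₂, hUV⟩ := t2_separation (x := p τ₁) (y := p τ₂) fun h ↦
    (exists_smul_eq_iff_quotientMk_eq.mpr h).elim hne
  filter_upwards [(isOpenMap_jInv _ (hU.preimage hp)).mem_nhds ⟨τ₁, hτ₁, h₁⟩,
    (isOpenMap_jInv _ (hV.preimage hp)).mem_nhds ⟨τ₂, hτ₂, h₂⟩]
  rintro _ ⟨x, hx, rfl⟩ ⟨y, hy, hxy⟩
  exact ⟨x, y, rfl, hxy, fun γ hγ ↦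
    hUV.ne_of_mem hx hy (exists_smul_eq_iff_quotientMk_eq.mp ⟨γ, hγ⟩)⟩

lemma isBounded_jInvMultipleValues : Bornology.IsBounded jInvMultipleValues := by
  obtain ⟨Y, hY⟩ := exists_smul_eq_of_jInv_eq_of_lt_im
  refine ((ModularGroup.isCompact_truncatedFundamentalDomain Y).image
    continuous_jInv).isBounded.subset fun c hc ↦ ?_
  obtain ⟨τ₁, hτ₁, τ₂, hτ₂, h₁, h₂, hne⟩ := exists_mem_fd_of_mem_jInvMultipleValues hc
  by_contra hlow
  have him : ∀ τ ∈ 𝒟, jInv τ = c → Y < τ.im := fun τ hτ hj ↦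
    not_le.mp fun hle ↦ hlow ⟨τ, ⟨hτ, hle⟩, hj⟩
  exact (hY _ _ (him _ hτ₁ h₁) (him _ hτ₂ h₂) (h₁.trans h₂.symm)).elim hne

lemma exists_isCompact_of_norm_jInv_le (R : ℝ) :
    ∃ K : Set ℍ, IsCompact K ∧ ∀ τ ∈ 𝒟, ‖jInv τ‖ ≤ R → τ ∈ K := by
  obtain ⟨Y, hY⟩ := (atImInfty_mem _).mp (tendsto_norm_jInv_atImInfty.eventually_gt_atTop R)
  refine ⟨_, ModularGroup.isCompact_truncatedFundamentalDomain Y, fun τ hτ hle ↦ ⟨hτ, ?_⟩⟩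
  exact not_lt.mp fun hlt ↦ (show R < ‖jInv τ‖ from hY τ hlt.le).not_ge hle

lemma exists_deriv_jInv_eq_zero_of_mem_frontier {c : ℂ} (hc : c ∈ frontier jInvMultipleValues) :
    ∃ τ : ℍ, deriv (jInv ∘ ofComplex) τ = 0 ∧ jInv τ = c := by
  rw [isOpen_jInvMultipleValues.frontier_eq] at hc
  obtain ⟨u, hu, hlim⟩ := mem_closure_iff_seq_limit.mp hc.1
  choose x hx y hy hjx hjy hne using fun n ↦ exists_mem_fd_of_mem_jInvMultipleValues (hu n)
  obtain ⟨R, hR⟩ := (isBounded_range_of_tendsto _ hlim).exists_norm_le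
  obtain ⟨K, hK, hmem⟩ := exists_isCompact_of_norm_jInv_le R
  obtain ⟨⟨a, b⟩, -, φ, hφ, hab⟩ := (hK.prod hK).tendsto_subseq (x := fun n ↦ (x n, y n)) fun n ↦
    ⟨hmem _ (hx n) (hjx n ▸ hR _ ⟨n, rfl⟩), hmem _ (hy n) (hjy n ▸ hR _ ⟨n, rfl⟩)⟩
  obtain ⟨ha, hb⟩ := (Prod.tendsto_iff _ _).mp hab
  have hjlim {v : ℕ → ℍ} {l : ℍ} (hv : Tendsto (v ∘ φ) atTop (𝓝 l)) (hj : ∀ n, jInv (v n) = u n) :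
      jInv l = c :=
    tendsto_nhds_unique ((continuous_jInv.tendsto l).comp hv)
      ((hlim.comp hφ.tendsto_atTop).congr fun n ↦ (hj _).symm)
  have hja : jInv a = c := hjlim ha hjx
  have hγ : ∃ γ : SL(2, ℤ), γ • a = b := by
    by_contra! hab
    exact hc.2 ⟨a, b, hja, hjlim hb hjy, hab⟩
  obtain ⟨γ, rfl⟩ := hγ
  exact ⟨a, deriv_jInv_eq_zero_of_tendsto ha hb (fun n ↦ (hjx _).trans (hjy _).symm)
    fun n ↦ hne (φ n), hja⟩

lemma jInvMultipleValues_eq_empty : jInvMultipleValues = ∅ :=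
  eq_empty_of_isOpen_of_isBounded_of_countable_frontier
    (by rw [Complex.rank_real_complex]; norm_num)
    isOpen_jInvMultipleValues isBounded_jInvMultipleValues
    ((countable_setOf_deriv_jInv_eq_zero.image jInv).mono
      fun _ hc ↦ exists_deriv_jInv_eq_zero_of_mem_frontier hc)

lemma exists_smul_eq_of_jInv_eq {τ₁ τ₂ : ℍ} (h : jInv τ₁ = jInv τ₂) :
    ∃ γ : SL(2, ℤ), γ • τ₁ = τ₂ := by
  by_contra! hne
  have hmem : jInv τ₂ ∈ jInvMultipleValues := ⟨τ₁, τ₂, h, rfl, hne⟩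
  rwa [jInvMultipleValues_eq_empty] at hmem

lemma gInfty_eq_of_jInv_eq {τ₁ τ₂ : ℍ} (h : jInv τ₁ = jInv τ₂) : gInfty τ₁ = gInfty τ₂ := by
  obtain ⟨γ, rfl⟩ := exists_smul_eq_of_jInv_eq h
  rw [gInfty_smul]

lemma existsUnique_gInfty_eq_comp_jInv : ∃! g : ℂ → ℝ, gInfty = g ∘ jInv := by
  refine ⟨fun c ↦ gInfty (Function.surjInv jInv_surjective c), ?_, fun g hg ↦ ?_⟩
  · funext τ
    exact gInfty_eq_of_jInv_eq (Function.surjInv_eq jInv_surjective (jInv τ)).symm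
  · funext c
    rw [hg, Function.comp_apply, Function.surjInv_eq jInv_surjective c]

end Bijectivity

section Roots

lemma cpow_one_div_pow (s : ℂ) {n : ℕ} (hn : n ≠ 0) : (s ^ (1 / n : ℂ)) ^ n = s := by
  rw [one_div, Complex.cpow_nat_inv_pow s hn]

lemma pow_mem_ball_iff {R : ℝ} (hR : 0 ≤ R) {n : ℕ} (hn : n ≠ 0) {w : ℂ} :
    w ^ n ∈ ball (0 : ℂ) (R ^ n) ↔ w ∈ ball (0 : ℂ) R := by
  rw [mem_ball_zero_iff, mem_ball_zero_iff, norm_pow,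
    pow_lt_pow_iff_left₀ (norm_nonneg w) hR hn]

lemma conj_mem_ball_zero_iff {R : ℝ} {z : ℂ} : conj z ∈ ball (0 : ℂ) R ↔ z ∈ ball (0 : ℂ) R := by
  simp only [mem_ball_zero_iff, Complex.norm_conj]

variable {α : Type*} {R : ℝ} {n : ℕ} {ω : ℂ}

lemma eq_of_pow_eq_pow_of_rotation_invariant [NeZero n] (hω : IsPrimitiveRoot ω n) {f : ℂ → α}
    (hinv : ∀ w ∈ ball (0 : ℂ) R, f (ω * w) = f w) {v w : ℂ} (hw : w ∈ ball (0 : ℂ) R)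
    (hvw : v ^ n = w ^ n) : f v = f w := by
  have hω1 : ‖ω‖ = 1 := Complex.norm_eq_one_of_pow_eq_one hω.pow_eq_one (NeZero.ne n)
  have hpow (i : ℕ) : f (ω ^ i * w) = f w := by
    induction i with
    | zero => rw [pow_zero, one_mul]
    | succ i ih =>
      have hi : ω ^ i * w ∈ ball (0 : ℂ) R := by simpa [hω1] using hw
      rw [pow_succ', mul_assoc, hinv _ hi, ih]
  rcases eq_or_ne w 0 with rfl | hw0
  · rw [zero_pow (NeZero.ne n), pow_eq_zero_iff (NeZero.ne n)] at hvw
    rw [hvw]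
  obtain ⟨i, -, hi⟩ := hω.eq_pow_of_pow_eq_one (ξ := v / w) <| by
    rw [div_pow, hvw, div_self (pow_ne_zero n hw0)]
  rw [← hpow i, hi, div_mul_cancel₀ v hw0]

-- Away from `0` the principal root may be replaced by a local inverse of `z ↦ z ^ n`.
lemma differentiableOn_comp_cpow_one_div [NeZero n] (hR : 0 < R) (hω : IsPrimitiveRoot ω n)
    {f : ℂ → ℂ} (hf : DifferentiableOn ℂ f (ball 0 R))
    (hinv : ∀ w ∈ ball (0 : ℂ) R, f (ω * w) = f w) :
    DifferentiableOn ℂ (fun s ↦ f (s ^ (1 / n : ℂ))) (ball 0 (R ^ n)) := by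
  have hn : n ≠ 0 := NeZero.ne n
  have hdiff {w : ℂ} (hw : w ∈ ball (0 : ℂ) R) : DifferentiableAt ℂ f w :=
    hf.differentiableAt (isOpen_ball.mem_nhds hw)
  refine (Complex.differentiableOn_compl_singleton_and_continuousAt_iff (c := 0)
    (ball_mem_nhds 0 (pow_pos hR n))).mp ⟨?_, ?_⟩
  · rintro s ⟨hs, hs0⟩
    obtain ⟨w, rfl⟩ : ∃ w, w ^ n = s := ⟨_, cpow_one_div_pow s hn⟩
    have hw : w ∈ ball (0 : ℂ) R := (pow_mem_ball_iff hR.le hn).mp hs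
    have hw' : (n : ℂ) * w ^ (n - 1) ≠ 0 :=
      mul_ne_zero (Nat.cast_ne_zero.mpr hn) (pow_ne_zero _ fun h ↦ hs0 (by simp [h, hn]))
    have hpow : HasStrictDerivAt (fun z : ℂ ↦ z ^ n) (n * w ^ (n - 1)) w :=
      hasStrictDerivAt_pow n w
    have heq : (fun t ↦ f (t ^ (1 / n : ℂ))) =ᶠ[𝓝 (w ^ n)]
        f ∘ hpow.localInverse _ _ _ hw' := by
      filter_upwards [hpow.eventually_right_inverse hw', isOpen_ball.mem_nhds hs] with t hinvt ht
      refine eq_of_pow_eq_pow_of_rotation_invariant hω hinv ?_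
        ((cpow_one_div_pow t hn).trans hinvt.symm)
      rwa [← pow_mem_ball_iff hR.le hn, hinvt]
    refine (DifferentiableAt.congr_of_eventuallyEq ?_ heq).differentiableWithinAt
    refine DifferentiableAt.comp (w ^ n) ?_ (hpow.to_localInverse hw').hasDerivAt.differentiableAt
    rw [(hpow.eventually_left_inverse hw').self_of_nhds]
    exact hdiff hw
  · have hroot : ContinuousAt (fun s : ℂ ↦ s ^ (1 / n : ℂ)) 0 :=
      Complex.continuousAt_cpow_const_of_re_pos (by simp)
        (by simpa using Nat.pos_of_ne_zero hn)
    refine ContinuousAt.comp' (g := f) ?_ hroot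
    rw [Complex.zero_cpow (by simpa using hn)]
    exact (hdiff (mem_ball_self hR)).continuousAt

end Roots

section Logarithm

variable {R : ℝ} {f : ℂ → ℂ}

lemma eqOn_of_cexp_eq {U : Set ℂ} (hU : IsOpen U) (hU' : IsPreconnected U) {f g : ℂ → ℂ}
    (hf : DifferentiableOn ℂ f U) (hg : DifferentiableOn ℂ g U)
    (hexp : ∀ z ∈ U, Complex.exp (f z) = Complex.exp (g z)) {z₀ : ℂ} (hz₀ : z₀ ∈ U)
    (hfg : f z₀ = g z₀) : EqOn f g U := by
  refine hU.eqOn_of_deriv_eq hU' hf hg (fun z hz ↦ ?_) hz₀ hfg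
  have hnhds := hU.mem_nhds hz
  have hexpf := (hf.differentiableAt hnhds).hasDerivAt.cexp
  have hexpg := (hg.differentiableAt hnhds).hasDerivAt.cexp
  have huniq := hexpf.unique <| hexpg.congr_of_eventuallyEq <| by
    filter_upwards [hnhds] with x hx using hexp x hx
  rw [hexp z hz] at huniq
  exact mul_left_cancel₀ (Complex.exp_ne_zero _) huniq

lemma differentiableOn_conj_conj (hf : DifferentiableOn ℂ f (ball 0 R)) :
    DifferentiableOn ℂ (fun z ↦ conj (f (conj z))) (ball 0 R) := fun z hz ↦ by
  have hderiv := (hf.differentiableAt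
    (isOpen_ball.mem_nhds (conj_mem_ball_zero_iff.mpr hz))).hasDerivAt.conj_conj
  rw [Complex.conj_conj] at hderiv
  exact hderiv.differentiableAt.differentiableWithinAt

lemma exists_differentiableOn_mul_cexp_eq {c : ℂ} (hf : DifferentiableOn ℂ f (ball c R))
    (hne : ∀ z ∈ ball c R, f z ≠ 0) :
    ∃ L : ℂ → ℂ, DifferentiableOn ℂ L (ball c R) ∧ L c = 0 ∧
      ∀ z ∈ ball c R, f c * Complex.exp (L z) = f z := by
  obtain ⟨L, hLc, hL⟩ :=
    ((hf.deriv isOpen_ball).div hf hne).isExactOn_ball.with_val_at c 0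
  have hquot (z : ℂ) (hz : z ∈ ball c R) :
      HasDerivAt (fun z ↦ f z * Complex.exp (-L z)) 0 z := by
    have hfz := hne z hz
    refine ((hf.differentiableAt (isOpen_ball.mem_nhds hz)).hasDerivAt.mul
      (hL z hz).neg.cexp).congr_deriv ?_
    simp only [Pi.div_apply]
    field_simp
    ring
  refine ⟨L, fun z hz ↦ (hL z hz).differentiableAt.differentiableWithinAt, hLc, fun z hz ↦ ?_⟩
  have hconst := isOpen_ball.is_const_of_deriv_eq_zero (convex_ball c R).isPreconnected
    (fun z hz ↦ (hquot z hz).differentiableAt.differentiableWithinAt)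
    (fun z hz ↦ (hquot z hz).deriv) hz (mem_ball_self (nonempty_ball.mp ⟨z, hz⟩))
  simp only [hLc, neg_zero, Complex.exp_zero, mul_one] at hconst
  rw [← hconst, mul_assoc, ← Complex.exp_add, neg_add_cancel, Complex.exp_zero, mul_one]

lemma log_conj_of_mul_cexp_eq {L : ℂ → ℂ} (hL : DifferentiableOn ℂ L (ball 0 R)) (hL0 : L 0 = 0)
    (hf0 : f 0 ≠ 0) (hexp : ∀ z ∈ ball (0 : ℂ) R, f 0 * Complex.exp (L z) = f z)
    (hconj : ∀ z ∈ ball (0 : ℂ) R, f (conj z) = conj (f z)) {z : ℂ} (hz : z ∈ ball (0 : ℂ) R) :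
    L (conj z) = conj (L z) := by
  have h0 : (0 : ℂ) ∈ ball (0 : ℂ) R := mem_ball_self (nonempty_ball.mp ⟨z, hz⟩)
  have hf0_conj : conj (f 0) = f 0 := by rw [← hconj 0 h0, map_zero]
  have heq := eqOn_of_cexp_eq isOpen_ball (convex_ball 0 R).isPreconnected
    (differentiableOn_conj_conj hL) hL (fun z hz ↦ mul_left_cancel₀ hf0 ?_) h0 (by simp [hL0])
  · rw [← heq hz, Complex.conj_conj]
  · have hz' := conj_mem_ball_zero_iff.mpr hz
    calc f 0 * Complex.exp (conj (L (conj z))) = conj (f 0 * Complex.exp (L (conj z))) := by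
          rw [map_mul, hf0_conj, Complex.exp_conj]
      _ = f 0 * Complex.exp (L z) := by
          rw [hexp _ hz', hconj z hz, Complex.conj_conj, hexp z hz]

end Logarithm

section RealTaylor

open scoped Nat

/-- The `n`-th Taylor coefficient at `0` of a function that is real on the real axis. -/
noncomputable def realTaylorCoeff (f : ℂ → ℂ) (n : ℕ) : ℝ := (iteratedDeriv n f 0).re / n !

/-- `f` is holomorphic and bounded by `K` on the disc of radius `R` about `0`, vanishes at `0`, and
commutes with complex conjugation; equivalently to the last, its Taylor coefficients are real. -/
structure IsRealBoundedOnBall (f : ℂ → ℂ) (R K : ℝ) : Prop where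
  differentiableOn : DifferentiableOn ℂ f (ball 0 R)
  map_zero : f 0 = 0
  map_conj : ∀ z ∈ ball (0 : ℂ) R, f (conj z) = conj (f z)
  norm_le : ∀ z ∈ ball (0 : ℂ) R, ‖f z‖ ≤ K

lemma ofReal_re_of_map_conj {f : ℂ → ℂ} {x : ℝ} (h : f (conj (x : ℂ)) = conj (f x)) :
    ((f x).re : ℂ) = f x :=
  Complex.conj_eq_iff_re.mp (by rw [← h, Complex.conj_ofReal])

lemma deriv_conj_of_map_conj {R : ℝ} {f : ℂ → ℂ} (hf : DifferentiableOn ℂ f (ball 0 R))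
    (hconj : ∀ z ∈ ball (0 : ℂ) R, f (conj z) = conj (f z)) {z : ℂ} (hz : z ∈ ball (0 : ℂ) R) :
    deriv f (conj z) = conj (deriv f z) := by
  have hderiv := (hf.differentiableAt (isOpen_ball.mem_nhds hz)).hasDerivAt.conj_conj
  refine (hderiv.congr_of_eventuallyEq ?_).deriv
  filter_upwards [isOpen_ball.mem_nhds (conj_mem_ball_zero_iff.mpr hz)] with x hx
  rw [Function.comp_apply, Function.comp_apply, ← hconj _ (conj_mem_ball_zero_iff.mpr hx),
    Complex.conj_conj]

lemma iteratedDeriv_conj_of_map_conj {R : ℝ} {f : ℂ → ℂ} (hf : DifferentiableOn ℂ f (ball 0 R))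
    (hconj : ∀ z ∈ ball (0 : ℂ) R, f (conj z) = conj (f z)) (n : ℕ) :
    DifferentiableOn ℂ (iteratedDeriv n f) (ball 0 R) ∧
      ∀ z ∈ ball (0 : ℂ) R, iteratedDeriv n f (conj z) = conj (iteratedDeriv n f z) := by
  induction n with
  | zero => simpa using ⟨hf, by simpa using hconj⟩
  | succ n ih =>
    rw [iteratedDeriv_succ]
    exact ⟨ih.1.deriv isOpen_ball, fun z hz ↦ deriv_conj_of_map_conj ih.1 ih.2 hz⟩

lemma norm_pow_sub_pow_le {r : ℝ} {a b : ℂ} (ha : ‖a‖ ≤ r) (hb : ‖b‖ ≤ r) (m : ℕ) :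
    ‖a ^ (m + 1) - b ^ (m + 1)‖ ≤ (m + 1) * r ^ m * ‖a - b‖ := by
  have hr : 0 ≤ r := (norm_nonneg a).trans ha
  induction m with
  | zero => simp
  | succ m ih =>
    calc ‖a ^ (m + 1 + 1) - b ^ (m + 1 + 1)‖
        = ‖a * (a ^ (m + 1) - b ^ (m + 1)) + (a - b) * b ^ (m + 1)‖ := by congr 1; ring
      _ ≤ ‖a‖ * ‖a ^ (m + 1) - b ^ (m + 1)‖ + ‖a - b‖ * ‖b‖ ^ (m + 1) := by
          refine (norm_add_le _ _).trans ?_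
          rw [norm_mul, norm_mul, norm_pow]
      _ ≤ r * ((m + 1) * r ^ m * ‖a - b‖) + ‖a - b‖ * r ^ (m + 1) := by gcongr
      _ = ((m + 1 : ℕ) + 1) * r ^ (m + 1) * ‖a - b‖ := by push_cast; ring

lemma sq_norm_ofReal_norm_sub (z : ℂ) : ‖(‖z‖ : ℂ) - z‖ ^ 2 = 2 * ‖z‖ * (‖z‖ - z.re) := by
  have hz : ‖z‖ ^ 2 = z.re ^ 2 + z.im ^ 2 := by
    rw [← Complex.normSq_eq_norm_sq, Complex.normSq_apply, sq, sq]
  rw [← Complex.normSq_eq_norm_sq, Complex.normSq_apply]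
  simp only [Complex.sub_re, Complex.ofReal_re, Complex.sub_im, Complex.ofReal_im]
  linear_combination -hz

lemma norm_pow_sub_re_pow_le (s : ℂ) (m : ℕ) :
    ‖s‖ ^ (m + 1) - (s ^ (m + 1)).re ≤ (m + 1) ^ 2 * ‖s‖ ^ m * (‖s‖ - s.re) := by
  rcases eq_or_ne s 0 with rfl | hs
  · simp
  have hpos : 0 < 2 * ‖s‖ ^ (m + 1) := by positivity
  refine le_of_mul_le_mul_left ?_ hpos
  calc 2 * ‖s‖ ^ (m + 1) * (‖s‖ ^ (m + 1) - (s ^ (m + 1)).re)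
      = ‖(‖s‖ : ℂ) ^ (m + 1) - s ^ (m + 1)‖ ^ 2 := by
        have hpow := sq_norm_ofReal_norm_sub (s ^ (m + 1))
        rw [norm_pow] at hpow
        rw [← hpow, Complex.ofReal_pow]
    _ ≤ ((m + 1) * ‖s‖ ^ m * ‖(‖s‖ : ℂ) - s‖) ^ 2 := by
        gcongr
        exact norm_pow_sub_pow_le (by simp) le_rfl m
    _ = 2 * ‖s‖ ^ (m + 1) * ((m + 1) ^ 2 * ‖s‖ ^ m * (‖s‖ - s.re)) := by
        rw [mul_pow, sq_norm_ofReal_norm_sub]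
        ring

namespace IsRealBoundedOnBall

variable {f : ℂ → ℂ} {R K r : ℝ} {s : ℂ}

lemma realTaylorCoeff_zero (hf : IsRealBoundedOnBall f R K) : realTaylorCoeff f 0 = 0 := by
  simp [realTaylorCoeff, hf.map_zero]

lemma ofReal_realTaylorCoeff (hf : IsRealBoundedOnBall f R K) (hR : 0 < R) (n : ℕ) :
    (realTaylorCoeff f n : ℂ) = iteratedDeriv n f 0 / n ! := by
  have hreal : conj (iteratedDeriv n f 0) = iteratedDeriv n f 0 := by
    rw [← (iteratedDeriv_conj_of_map_conj hf.differentiableOn hf.map_conj n).2 0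
      (mem_ball_self hR), _root_.map_zero]
  rw [realTaylorCoeff, Complex.ofReal_div, Complex.conj_eq_iff_re.mp hreal, Complex.ofReal_natCast]

lemma hasSum (hf : IsRealBoundedOnBall f R K) (hs : s ∈ ball (0 : ℂ) R) :
    HasSum (fun n ↦ (realTaylorCoeff f n : ℂ) * s ^ n) (f s) := by
  refine (Complex.hasSum_taylorSeries_on_ball hf.differentiableOn hs).congr_fun fun n ↦ ?_
  rw [hf.ofReal_realTaylorCoeff (nonempty_ball.mp ⟨s, hs⟩), sub_zero, smul_eq_mul, smul_eq_mul]
  ring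

lemma hasSum_mul_deriv (hf : IsRealBoundedOnBall f R K) (hs : s ∈ ball (0 : ℂ) R) :
    HasSum (fun n ↦ (realTaylorCoeff f n * n : ℂ) * s ^ n) (s * deriv f s) := by
  rw [← hasSum_nat_add_iff' 1, Finset.sum_range_one, Nat.cast_zero, mul_zero, zero_mul, sub_zero]
  refine ((Complex.hasSum_taylorSeries_on_ball (hf.differentiableOn.deriv isOpen_ball)
    hs).mul_left s).congr_fun fun n ↦ ?_
  have hn : (n ! : ℂ) ≠ 0 := Nat.cast_ne_zero.mpr n.factorial_ne_zero
  have hn1 : (n + 1 : ℂ) ≠ 0 := Nat.cast_add_one_ne_zero n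
  rw [hf.ofReal_realTaylorCoeff (nonempty_ball.mp ⟨s, hs⟩), iteratedDeriv_succ',
    Nat.factorial_succ, sub_zero, smul_eq_mul, smul_eq_mul]
  push_cast
  field_simp
  ring

lemma abs_realTaylorCoeff_le (hf : IsRealBoundedOnBall f R K) (hR : 0 < R) (n : ℕ) :
    |realTaylorCoeff f n| ≤ K / R ^ n := by
  rw [le_div_iff₀ (by positivity)]
  have hcauchy (r : ℝ) (hr : r ∈ Ioo 0 R) : |realTaylorCoeff f n| * r ^ n ≤ K := by
    have hsub : closedBall (0 : ℂ) r ⊆ ball 0 R := closedBall_subset_ball hr.2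
    have hderiv := Complex.norm_iteratedDeriv_le_of_forall_mem_sphere_norm_le n hr.1
      ((hf.differentiableOn.mono hsub).diffContOnCl_ball subset_rfl)
      fun z hz ↦ hf.norm_le z (hsub (sphere_subset_closedBall hz))
    have hfact : (0 : ℝ) < n ! := Nat.cast_pos.mpr n.factorial_pos
    have hrn : 0 < r ^ n := pow_pos hr.1 n
    rw [realTaylorCoeff, abs_div, Nat.abs_cast, div_mul_eq_mul_div, div_le_iff₀ hfact,
      mul_comm K, ← le_div_iff₀ hrn]
    exact (Complex.abs_re_le_norm _).trans hderiv
  have hlim : Tendsto (fun r ↦ |realTaylorCoeff f n| * r ^ n) (𝓝[<] R)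
      (𝓝 (|realTaylorCoeff f n| * R ^ n)) :=
    (Continuous.tendsto (by fun_prop) R).mono_left nhdsWithin_le_nhds
  exact le_of_tendsto hlim (eventually_of_mem (Ioo_mem_nhdsLT hR) hcauchy)

lemma abs_re_sub_linear_le (hf : IsRealBoundedOnBall f R K) (hs : s ∈ ball (0 : ℂ) R) :
    |(f s).re - realTaylorCoeff f 1 * s.re| ≤ K * (‖s‖ / R) ^ 2 / (1 - ‖s‖ / R) := by
  have hR : 0 < R := nonempty_ball.mp ⟨s, hs⟩
  have htail : HasSum (fun n ↦ (realTaylorCoeff f (n + 2) : ℂ) * s ^ (n + 2))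
      (f s - realTaylorCoeff f 1 * s) := by
    simpa [Finset.sum_range_succ, hf.realTaylorCoeff_zero] using
      (hasSum_nat_add_iff' 2).mpr (hf.hasSum hs)
  have hgeom := (hasSum_geometric_of_lt_one (by positivity)
    ((div_lt_one hR).mpr (mem_ball_zero_iff.mp hs))).mul_left (K * (‖s‖ / R) ^ 2)
  have hle (n : ℕ) : ‖(realTaylorCoeff f (n + 2) : ℂ) * s ^ (n + 2)‖ ≤
      K * (‖s‖ / R) ^ 2 * (‖s‖ / R) ^ n :=
    calc ‖(realTaylorCoeff f (n + 2) : ℂ) * s ^ (n + 2)‖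
        = |realTaylorCoeff f (n + 2)| * ‖s‖ ^ (n + 2) := by
          rw [norm_mul, norm_pow, Complex.norm_real, Real.norm_eq_abs]
      _ ≤ K / R ^ (n + 2) * ‖s‖ ^ (n + 2) := by
          gcongr
          exact hf.abs_realTaylorCoeff_le hR _
      _ = K * (‖s‖ / R) ^ 2 * (‖s‖ / R) ^ n := by
          rw [mul_assoc, ← pow_add, add_comm 2 n, div_pow]
          ring
  have hbound := tsum_of_norm_bounded hgeom hle
  rw [htail.tsum_eq] at hbound
  simpa [Complex.sub_re, Complex.re_ofReal_mul, ← div_eq_mul_inv] using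
    (Complex.abs_re_le_norm _).trans hbound

-- The constant is `∑ₙ≥₂ n² xⁿ⁻¹ ≤ 4x ∑ₙ (n+2 choose 2) xⁿ` with `x = r / R`.
lemma abs_sub_linear_term_le (hf : IsRealBoundedOnBall f R K) (hr : 0 ≤ r) (hrR : r < R)
    {δ T : ℝ} (hδ : 0 ≤ δ) {t : ℕ → ℝ} (ht : ∀ n : ℕ, |t (n + 1)| ≤ (n + 1) ^ 2 * r ^ n * δ)
    (hT : HasSum (fun n ↦ realTaylorCoeff f n * t n) T) :
    |T - realTaylorCoeff f 1 * t 1| ≤ δ * (K / R * (4 * (r / R) / (1 - r / R) ^ 3)) := by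
  have hR : 0 < R := hr.trans_lt hrR
  have hK : 0 ≤ K := (norm_nonneg _).trans (hf.norm_le 0 (mem_ball_self hR))
  set x := r / R with hx
  have hx0 : 0 ≤ x := by positivity
  have hx1 : ‖x‖ < 1 := by rwa [Real.norm_of_nonneg hx0, div_lt_one hR]
  have htail : HasSum (fun n ↦ realTaylorCoeff f (n + 2) * t (n + 2))
      (T - realTaylorCoeff f 1 * t 1) := by
    simpa [Finset.sum_range_succ, hf.realTaylorCoeff_zero] using (hasSum_nat_add_iff' 2).mpr hT
  have hgeom := (hasSum_choose_mul_geometric_of_norm_lt_one 2 hx1).mul_left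
    (δ * (K / R) * (4 * x))
  have hle (n : ℕ) : ‖realTaylorCoeff f (n + 2) * t (n + 2)‖ ≤
      δ * (K / R) * (4 * x) * (((n + 2).choose 2 : ℕ) * x ^ n) := by
    have hchoose : (((n + 2).choose 2 : ℕ) : ℝ) = (n + 2) * (n + 1) / 2 := by
      rw [Nat.cast_choose_two]; push_cast; ring
    calc ‖realTaylorCoeff f (n + 2) * t (n + 2)‖
        ≤ K / R ^ (n + 2) * (((n + 1 : ℕ) + 1) ^ 2 * r ^ (n + 1) * δ) := by
          rw [norm_mul]
          exact mul_le_mul (hf.abs_realTaylorCoeff_le hR _) (ht (n + 1)) (norm_nonneg _)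
            (by positivity)
      _ = δ * (K / R) * x * ((n + 2 : ℝ) ^ 2 * x ^ n) := by
          rw [hx, div_pow, pow_succ r, pow_succ R, pow_succ R]
          push_cast
          field_simp
          ring
      _ ≤ δ * (K / R) * x * ((4 * ((n + 2) * (n + 1) / 2)) * x ^ n) := by
          gcongr
          nlinarith [(Nat.cast_nonneg n : (0 : ℝ) ≤ n)]
      _ = δ * (K / R) * (4 * x) * (((n + 2).choose 2 : ℕ) * x ^ n) := by rw [hchoose]; ring
  have hbound := tsum_of_norm_bounded hgeom hle
  rw [htail.tsum_eq, Real.norm_eq_abs] at hbound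
  exact hbound.trans_eq (by ring)

lemma abs_re_norm_sub_re_sub_linear_le (hf : IsRealBoundedOnBall f R K)
    (hs : s ∈ ball (0 : ℂ) R) :
    |(f ‖s‖).re - (f s).re - realTaylorCoeff f 1 * (‖s‖ - s.re)| ≤
      (‖s‖ - s.re) * (K / R * (4 * (‖s‖ / R) / (1 - ‖s‖ / R) ^ 3)) := by
  have hsum : HasSum (fun n ↦ realTaylorCoeff f n * (‖s‖ ^ n - (s ^ n).re))
      ((f ‖s‖).re - (f s).re) := by
    refine ((Complex.hasSum_re (hf.hasSum (s := ‖s‖) (by simpa using hs))).sub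
      (Complex.hasSum_re (hf.hasSum hs))).congr_fun fun n ↦ ?_
    rw [← Complex.ofReal_pow, ← Complex.ofReal_mul, Complex.ofReal_re, Complex.re_ofReal_mul]
    ring
  have hdefect (n : ℕ) : |‖s‖ ^ (n + 1) - (s ^ (n + 1)).re| ≤
      (n + 1) ^ 2 * ‖s‖ ^ n * (‖s‖ - s.re) := by
    rw [abs_of_nonneg (sub_nonneg.mpr (norm_pow s (n + 1) ▸ Complex.re_le_norm _))]
    exact norm_pow_sub_re_pow_le s n
  simpa using hf.abs_sub_linear_term_le (norm_nonneg s) (mem_ball_zero_iff.mp hs)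
    (sub_nonneg.mpr (Complex.re_le_norm s)) hdefect hsum

lemma abs_re_mul_deriv_sub_sub_linear_le (hf : IsRealBoundedOnBall f R K) (hrR : r < R) {a b : ℝ}
    (ha : |a| ≤ r) (hb : |b| ≤ r) :
    |(a * deriv f a).re - (b * deriv f b).re - realTaylorCoeff f 1 * (a - b)| ≤
      |a - b| * (K / R * (4 * (r / R) / (1 - r / R) ^ 3)) := by
  have hsum : HasSum (fun n ↦ realTaylorCoeff f n * (n * (a ^ n - b ^ n)))
      ((a * deriv f a).re - (b * deriv f b).re) := by
    refine ((Complex.hasSum_re (hf.hasSum_mul_deriv (s := a)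
      (by simpa using ha.trans_lt hrR))).sub (Complex.hasSum_re (hf.hasSum_mul_deriv (s := b)
      (by simpa using hb.trans_lt hrR)))).congr_fun fun n ↦ ?_
    simp only [← Complex.ofReal_natCast, ← Complex.ofReal_pow, ← Complex.ofReal_mul,
      Complex.ofReal_re]
    ring
  have hpow (n : ℕ) : |((n + 1 : ℕ) : ℝ) * (a ^ (n + 1) - b ^ (n + 1))| ≤
      (n + 1) ^ 2 * r ^ n * |a - b| := by
    have hdiff := norm_pow_sub_pow_le (a := a) (b := b) (by simpa using ha) (by simpa using hb) n
    norm_cast at hdiff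
    calc |((n + 1 : ℕ) : ℝ) * (a ^ (n + 1) - b ^ (n + 1))|
        = (n + 1) * |a ^ (n + 1) - b ^ (n + 1)| := by rw [abs_mul, Nat.abs_cast, Nat.cast_succ]
      _ ≤ (n + 1) * ((n + 1) * r ^ n * |a - b|) := by
          gcongr
          simpa using hdiff
      _ = (n + 1) ^ 2 * r ^ n * |a - b| := by ring
  simpa using hf.abs_sub_linear_term_le ((abs_nonneg a).trans ha) hrR (abs_nonneg (a - b)) hpow hsum

end IsRealBoundedOnBall

end RealTaylor

section DiscCoordinate

lemma conj_ρ : conj (ρ : ℂ) = -1 - ρ := by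
  apply Complex.ext
  · simp [ρ]
    norm_num
  · simp [ρ]

lemma ρ_sq_add : (ρ : ℂ) ^ 2 + ρ + 1 = 0 := by
  rw [ρ_sq]
  ring

lemma conj_ρ_mul_ρ : conj (ρ : ℂ) * ρ = 1 := by
  rw [conj_ρ]
  linear_combination -ρ_sq_add

lemma conj_ρ_pow_three : conj (ρ : ℂ) ^ 3 = 1 := by
  rw [conj_ρ]
  linear_combination (-ρ - 2) * ρ_sq_add

lemma coe_sub_conj_ρ_ne_zero (τ : ℍ) : (τ : ℂ) - conj (ρ : ℂ) ≠ 0 := fun h ↦ by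
  have him : τ.im + ρ.im = 0 := by simpa using congrArg Complex.im h
  exact (add_pos τ.im_pos ρ.im_pos).ne' him

lemma conj_ρ_ne_one : conj (ρ : ℂ) ≠ 1 := fun h ↦ by
  have him : ρ.im = 0 := by simpa using congrArg Complex.im h
  exact ρ.im_pos.ne' him

lemma isPrimitiveRoot_conj_ρ : IsPrimitiveRoot (conj (ρ : ℂ)) 3 :=
  IsPrimitiveRoot.iff_orderOf.mpr (orderOf_eq_prime conj_ρ_pow_three conj_ρ_ne_one)

/-- The Cayley transform from the unit disc to the upper half-plane sending `0` to `ρ`. -/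
noncomputable def discTau (w : ℂ) : ℂ := (ρ + conj (ρ : ℂ) * w) / (1 + w)

/-- The inverse of `discTau`. -/
noncomputable def discCoord (τ : ℍ) : ℂ := (ρ - τ) / (τ - conj (ρ : ℂ))

/-- The point of the upper half-plane with disc coordinate `w`; meaningful for `‖w‖ < 1` only. -/
noncomputable def discPoint (w : ℂ) : ℍ := ofComplex (discTau w)

variable {w : ℂ}

lemma one_add_ne_zero_of_mem_ball (hw : w ∈ ball (0 : ℂ) 1) : 1 + w ≠ 0 := fun h ↦ by
  rw [← neg_eq_of_add_eq_zero_right h] at hw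
  simp at hw

lemma one_sub_sq_norm_pos (hw : w ∈ ball (0 : ℂ) 1) : 0 < 1 - ‖w‖ ^ 2 :=
  sub_pos.mpr (pow_lt_one₀ (norm_nonneg w) (mem_ball_zero_iff.mp hw) two_ne_zero)

lemma im_discTau (w : ℂ) : (discTau w).im = √3 / 2 * ((1 - ‖w‖ ^ 2) / ‖1 + w‖ ^ 2) := by
  rw [discTau, Complex.div_im, ← Complex.normSq_eq_norm_sq, ← Complex.normSq_eq_norm_sq]
  simp only [Complex.normSq_apply, Complex.add_re, Complex.add_im, Complex.one_re, Complex.one_im,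
    Complex.mul_re, Complex.mul_im, Complex.conj_re, Complex.conj_im, ρ]
  ring

lemma im_discTau_pos (hw : w ∈ ball (0 : ℂ) 1) : 0 < (discTau w).im := by
  have hnum := one_sub_sq_norm_pos hw
  have hden : 0 < ‖1 + w‖ := norm_pos_iff.mpr (one_add_ne_zero_of_mem_ball hw)
  rw [im_discTau]
  positivity

lemma discTau_discCoord (τ : ℍ) : discTau (discCoord τ) = τ := by
  have hτ := coe_sub_conj_ρ_ne_zero τ
  have hρ := coe_sub_conj_ρ_ne_zero ρ
  have hadd : 1 + discCoord τ = (ρ - conj (ρ : ℂ)) / (τ - conj (ρ : ℂ)) := by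
    rw [discCoord]
    field_simp
    ring
  rw [discTau, hadd, discCoord]
  field_simp
  ring

lemma discCoord_mem_ball (τ : ℍ) : discCoord τ ∈ ball (0 : ℂ) 1 := by
  have him : 0 < √3 / 2 * ((1 - ‖discCoord τ‖ ^ 2) / ‖1 + discCoord τ‖ ^ 2) := by
    rw [← im_discTau, discTau_discCoord]
    exact τ.im_pos
  rw [mem_ball_zero_iff]
  contrapose! him
  have hsq : 1 - ‖discCoord τ‖ ^ 2 ≤ 0 := sub_nonpos.mpr (one_le_pow₀ him)
  exact mul_nonpos_of_nonneg_of_nonpos (by positivity)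
    (div_nonpos_of_nonpos_of_nonneg hsq (by positivity))

lemma differentiableOn_discTau : DifferentiableOn ℂ discTau (ball 0 1) :=
  DifferentiableOn.div (by fun_prop) (by fun_prop) fun _ hw ↦ one_add_ne_zero_of_mem_ball hw

lemma coe_discPoint (hw : w ∈ ball (0 : ℂ) 1) : (discPoint w : ℂ) = discTau w := by
  rw [discPoint, ofComplex_apply_of_im_pos (im_discTau_pos hw)]

lemma discPoint_zero : discPoint 0 = ρ := by
  rw [discPoint, discTau, mul_zero, add_zero, add_zero, div_one, ofComplex_apply]

lemma discPoint_discCoord (τ : ℍ) : discPoint (discCoord τ) = τ := by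
  rw [discPoint, discTau_discCoord, ofComplex_apply]

lemma im_discPoint (hw : w ∈ ball (0 : ℂ) 1) :
    (discPoint w).im = √3 / 2 * ((1 - ‖w‖ ^ 2) / ‖1 + w‖ ^ 2) := by
  rw [← coe_im, coe_discPoint hw, im_discTau]

lemma conj_ρ_mul_mem_ball (hw : w ∈ ball (0 : ℂ) 1) : conj (ρ : ℂ) * w ∈ ball (0 : ℂ) 1 := by
  simpa [norm_ρ] using hw

lemma coe_T_smul_discPoint (hw : w ∈ ball (0 : ℂ) 1) :
    ((ModularGroup.T • discPoint w : ℍ) : ℂ) =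
      -(conj (ρ : ℂ) * (1 + conj (ρ : ℂ) * w) / (1 + w)) := by
  have hw1 := one_add_ne_zero_of_mem_ball hw
  rw [modular_T_smul, coe_vadd, coe_discPoint hw, discTau, Complex.ofReal_one]
  field_simp
  rw [conj_ρ]
  linear_combination w * ρ_sq_add

-- `S * T` fixes `ρ`, and its derivative there is the cube root of unity `conj ρ`.
lemma discPoint_rotate (hw : w ∈ ball (0 : ℂ) 1) :
    discPoint (conj (ρ : ℂ) * w) = ModularGroup.S • ModularGroup.T • discPoint w := by
  have hrot := one_add_ne_zero_of_mem_ball (conj_ρ_mul_mem_ball hw)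
  have hρ : conj (ρ : ℂ) ≠ 0 := isPrimitiveRoot_conj_ρ.ne_zero three_ne_zero
  ext1
  rw [modular_S_smul, coe_discPoint (conj_ρ_mul_mem_ball hw)]
  change discTau (conj (ρ : ℂ) * w) = (-((ModularGroup.T • discPoint w : ℍ) : ℂ))⁻¹
  rw [coe_T_smul_discPoint hw, neg_neg, inv_div, discTau,
    div_eq_div_iff hrot (mul_ne_zero hρ hrot)]
  linear_combination (1 + conj (ρ : ℂ) * w) * (conj_ρ_mul_ρ + w * conj_ρ_pow_three)

lemma denom_T (τ : ℍ) : denom ModularGroup.T τ = 1 := by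
  rw [ModularGroup.denom_apply]
  simp [ModularGroup.T]

/-- The discriminant in the disc coordinate, with its automorphy factor removed. -/
noncomputable def discDelta (w : ℂ) : ℂ := discriminant (discPoint w) / (1 + w) ^ 12

/-- The Eisenstein series `E₄` in the disc coordinate, with its automorphy factor removed. -/
noncomputable def discE₄ (w : ℂ) : ℂ := E₄ (discPoint w) / (1 + w) ^ 4

lemma discDelta_rotate (hw : w ∈ ball (0 : ℂ) 1) : discDelta (conj (ρ : ℂ) * w) = discDelta w := by
  have hw1 := one_add_ne_zero_of_mem_ball hw
  have hrot := one_add_ne_zero_of_mem_ball (conj_ρ_mul_mem_ball hw)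
  rw [discDelta, discPoint_rotate hw, discriminant_smul, discriminant_smul, ModularGroup.denom_S,
    coe_T_smul_discPoint hw, denom_T, discDelta]
  field_simp
  linear_combination (conj (ρ : ℂ) ^ 9 + conj (ρ : ℂ) ^ 6 + conj (ρ : ℂ) ^ 3 + 1) *
    discriminant (discPoint w) * conj_ρ_pow_three

lemma discE₄_rotate (hw : w ∈ ball (0 : ℂ) 1) :
    discE₄ (conj (ρ : ℂ) * w) = conj (ρ : ℂ) * discE₄ w := by
  have hw1 := one_add_ne_zero_of_mem_ball hw
  have hrot := one_add_ne_zero_of_mem_ball (conj_ρ_mul_mem_ball hw)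
  rw [discE₄, discPoint_rotate hw, E₄_smul, E₄_smul, ModularGroup.denom_S,
    coe_T_smul_discPoint hw, denom_T, discE₄]
  field_simp
  linear_combination conj (ρ : ℂ) * E₄ (discPoint w) * conj_ρ_pow_three

lemma differentiableOn_discDelta : DifferentiableOn ℂ discDelta (ball 0 1) :=
  ((UpperHalfPlane.mdifferentiable_iff.mp mdifferentiable_discriminant).comp
    differentiableOn_discTau fun _ hw ↦ im_discTau_pos hw).div (by fun_prop)
      fun _ hw ↦ pow_ne_zero _ (one_add_ne_zero_of_mem_ball hw)

lemma differentiableOn_discE₄ : DifferentiableOn ℂ discE₄ (ball 0 1) :=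
  ((UpperHalfPlane.mdifferentiable_iff.mp mdifferentiable_E₄).comp differentiableOn_discTau
    fun _ hw ↦ im_discTau_pos hw).div (by fun_prop)
      fun _ hw ↦ pow_ne_zero _ (one_add_ne_zero_of_mem_ball hw)

lemma coe_discPoint_conj (hw : w ∈ ball (0 : ℂ) 1) :
    (discPoint (conj w) : ℂ) = -1 - conj (discPoint w : ℂ) := by
  have hw' := conj_mem_ball_zero_iff.mpr hw
  rw [coe_discPoint hw, coe_discPoint hw', discTau, discTau]
  simp only [map_div₀, map_add, map_mul, map_one, Complex.conj_conj]
  rw [eq_sub_iff_add_eq, ← add_div, div_eq_iff (one_add_ne_zero_of_mem_ball hw'), conj_ρ]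
  ring

lemma eisensteinSeries_conj {k : ℕ} (hk : 3 ≤ k) (hk2 : Even k) {τ τ' : ℍ}
    (h : (τ' : ℂ) = -1 - conj (τ : ℂ)) : E hk τ' = conj (E hk τ) := by
  have hq : Complex.exp (2 * Real.pi * Complex.I * τ') =
      conj (Complex.exp (2 * Real.pi * Complex.I * τ)) := by
    rw [← Complex.exp_conj, h, Complex.exp_eq_exp_iff_exists_int]
    refine ⟨-1, ?_⟩
    simp only [map_mul, Complex.conj_I, Complex.conj_ofReal, map_ofNat]
    push_cast
    ring
  rw [EisensteinSeries.q_expansion_bernoulli hk hk2, EisensteinSeries.q_expansion_bernoulli hk hk2,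
    hq, map_sub, map_mul, Complex.conj_tsum]
  simp only [map_mul, map_zpow₀, map_one, map_div₀, map_natCast, map_ofNat, map_ratCast]

lemma discriminant_conj {τ τ' : ℍ} (h : (τ' : ℂ) = -1 - conj (τ : ℂ)) :
    discriminant τ' = conj (discriminant τ) := by
  rw [discriminant_eq_E₄_cube_sub_E₆_sq, discriminant_eq_E₄_cube_sub_E₆_sq,
    eisensteinSeries_conj _ ⟨2, rfl⟩ h, eisensteinSeries_conj _ ⟨3, rfl⟩ h]
  simp only [map_div₀, map_sub, map_pow, map_ofNat]

lemma discDelta_conj (hw : w ∈ ball (0 : ℂ) 1) : discDelta (conj w) = conj (discDelta w) := by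
  rw [discDelta, discriminant_conj (coe_discPoint_conj hw), discDelta]
  simp only [map_div₀, map_pow, map_add, map_one]

lemma discE₄_conj (hw : w ∈ ball (0 : ℂ) 1) : discE₄ (conj w) = conj (discE₄ w) := by
  rw [discE₄, eisensteinSeries_conj _ ⟨2, rfl⟩ (coe_discPoint_conj hw), discE₄]
  simp only [map_div₀, map_pow, map_add, map_one]

lemma discE₄_zero : discE₄ 0 = 0 := by
  have hrot := discE₄_rotate (mem_ball_self one_pos)
  rw [mul_zero] at hrot
  have hmul : (1 - conj (ρ : ℂ)) * discE₄ 0 = 0 := by linear_combination hrot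
  exact (mul_eq_zero.mp hmul).resolve_left (sub_ne_zero.mpr conj_ρ_ne_one.symm)

lemma discDelta_ne_zero (hw : w ∈ ball (0 : ℂ) 1) : discDelta w ≠ 0 :=
  div_ne_zero (discriminant_ne_zero _) (pow_ne_zero _ (one_add_ne_zero_of_mem_ball hw))

lemma dslope_discE₄_rotate (hw : w ∈ ball (0 : ℂ) 1) :
    dslope discE₄ 0 (conj (ρ : ℂ) * w) = dslope discE₄ 0 w := by
  rcases eq_or_ne w 0 with rfl | hw0
  · rw [mul_zero]
  have hρ : conj (ρ : ℂ) ≠ 0 := isPrimitiveRoot_conj_ρ.ne_zero three_ne_zero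
  rw [dslope_of_ne _ hw0, dslope_of_ne _ (mul_ne_zero hρ hw0), slope_def_field, slope_def_field,
    discE₄_rotate hw, discE₄_zero, sub_zero, sub_zero, sub_zero, sub_zero, mul_div_mul_left _ _ hρ]

lemma dslope_discE₄_conj (hw : w ∈ ball (0 : ℂ) 1) :
    dslope discE₄ 0 (conj w) = conj (dslope discE₄ 0 w) := by
  rcases eq_or_ne w 0 with rfl | hw0
  · have hderiv := deriv_conj_of_map_conj differentiableOn_discE₄ (fun _ ↦ discE₄_conj) hw
    rw [map_zero] at hderiv ⊢
    rw [dslope_same, ← hderiv]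
  · rw [dslope_of_ne _ hw0, dslope_of_ne _ (by simpa using hw0), slope_def_field, slope_def_field,
      discE₄_conj hw, discE₄_zero, sub_zero, sub_zero, sub_zero, sub_zero, map_div₀]

lemma pow_three_mem_ball_iff : w ^ 3 ∈ ball (0 : ℂ) 1 ↔ w ∈ ball (0 : ℂ) 1 := by
  simpa only [one_pow] using pow_mem_ball_iff zero_le_one three_ne_zero

lemma exists_mem_ball_pow_three_eq {s : ℂ} (hs : s ∈ ball (0 : ℂ) 1) :
    ∃ w ∈ ball (0 : ℂ) 1, w ^ 3 = s :=
  have hpow := cpow_one_div_pow s three_ne_zero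
  ⟨_, pow_three_mem_ball_iff.mp (hpow.symm ▸ hs), hpow⟩

/-- `discDelta` as a function of the cube of the disc coordinate. The choice of cube root is
immaterial because `discDelta` is invariant under rotation by `conj ρ`. -/
noncomputable def deltaHat (s : ℂ) : ℂ := discDelta (s ^ (1 / (3 : ℕ) : ℂ))

/-- `discE₄ w / w`, extended to `w = 0`, as a function of the cube of the disc coordinate. -/
noncomputable def eHat (s : ℂ) : ℂ := dslope discE₄ 0 (s ^ (1 / (3 : ℕ) : ℂ))

/-- The `j`-invariant as a function of the cube of the disc coordinate. -/
noncomputable def jHat (s : ℂ) : ℂ := s * eHat s ^ 3 / deltaHat s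

lemma differentiableOn_deltaHat : DifferentiableOn ℂ deltaHat (ball 0 1) := by
  rw [← one_pow (M := ℝ) 3]
  exact differentiableOn_comp_cpow_one_div one_pos isPrimitiveRoot_conj_ρ
    differentiableOn_discDelta fun _ ↦ discDelta_rotate

lemma differentiableOn_eHat : DifferentiableOn ℂ eHat (ball 0 1) := by
  rw [← one_pow (M := ℝ) 3]
  exact differentiableOn_comp_cpow_one_div one_pos isPrimitiveRoot_conj_ρ
    ((Complex.differentiableOn_dslope (ball_mem_nhds 0 one_pos)).mpr differentiableOn_discE₄)
      fun _ ↦ dslope_discE₄_rotate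

lemma deltaHat_pow (hw : w ∈ ball (0 : ℂ) 1) : deltaHat (w ^ 3) = discDelta w :=
  eq_of_pow_eq_pow_of_rotation_invariant isPrimitiveRoot_conj_ρ (fun _ ↦ discDelta_rotate) hw
    (cpow_one_div_pow _ three_ne_zero)

lemma eHat_pow (hw : w ∈ ball (0 : ℂ) 1) : eHat (w ^ 3) = dslope discE₄ 0 w :=
  eq_of_pow_eq_pow_of_rotation_invariant isPrimitiveRoot_conj_ρ (fun _ ↦ dslope_discE₄_rotate) hw
    (cpow_one_div_pow _ three_ne_zero)

lemma mul_eHat_pow (hw : w ∈ ball (0 : ℂ) 1) : w * eHat (w ^ 3) = discE₄ w := by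
  rw [eHat_pow hw]
  simpa [discE₄_zero] using sub_smul_dslope discE₄ 0 w

variable {s : ℂ}

lemma deltaHat_ne_zero (hs : s ∈ ball (0 : ℂ) 1) : deltaHat s ≠ 0 := by
  obtain ⟨w, hw, rfl⟩ := exists_mem_ball_pow_three_eq hs
  rw [deltaHat_pow hw]
  exact discDelta_ne_zero hw

lemma deltaHat_zero : deltaHat 0 = discriminant ρ := by
  have h := deltaHat_pow (mem_ball_self one_pos)
  rw [discDelta, discPoint_zero] at h
  simpa using h

lemma deltaHat_conj (hs : s ∈ ball (0 : ℂ) 1) : deltaHat (conj s) = conj (deltaHat s) := by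
  obtain ⟨w, hw, rfl⟩ := exists_mem_ball_pow_three_eq hs
  rw [map_pow, deltaHat_pow (conj_mem_ball_zero_iff.mpr hw), deltaHat_pow hw, discDelta_conj hw]

lemma eHat_conj (hs : s ∈ ball (0 : ℂ) 1) : eHat (conj s) = conj (eHat s) := by
  obtain ⟨w, hw, rfl⟩ := exists_mem_ball_pow_three_eq hs
  rw [map_pow, eHat_pow (conj_mem_ball_zero_iff.mpr hw), eHat_pow hw, dslope_discE₄_conj hw]

lemma jInv_discPoint (hw : w ∈ ball (0 : ℂ) 1) : jInv (discPoint w) = jHat (w ^ 3) := by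
  have hw1 := one_add_ne_zero_of_mem_ball hw
  have hΔ := discriminant_ne_zero (discPoint w)
  rw [jHat, ← mul_pow, mul_eHat_pow hw, deltaHat_pow hw, discE₄, discDelta, jInv]
  field_simp

lemma im_pow_six_mul_norm_discriminant_discPoint (hw : w ∈ ball (0 : ℂ) 1) :
    (discPoint w).im ^ 6 * ‖discriminant (discPoint w)‖ =
      27 / 64 * ((1 - ‖w‖ ^ 2) ^ 6 * ‖deltaHat (w ^ 3)‖) := by
  have hw1 : ‖1 + w‖ ≠ 0 := norm_ne_zero_iff.mpr (one_add_ne_zero_of_mem_ball hw)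
  have hsqrt : √3 ^ 6 = 27 := by
    rw [show √3 ^ 6 = (√3 ^ 2) ^ 3 by ring, Real.sq_sqrt (by norm_num)]
    norm_num
  rw [im_discPoint hw, deltaHat_pow hw, discDelta, norm_div, norm_pow, mul_pow, div_pow, div_pow,
    hsqrt]
  field_simp
  norm_num
  ring

lemma im_sq_mul_norm_E₄_discPoint (hw : w ∈ ball (0 : ℂ) 1) :
    (discPoint w).im ^ 2 * ‖E₄ (discPoint w)‖ = 3 / 4 * ((1 - ‖w‖ ^ 2) ^ 2 * ‖discE₄ w‖) := by
  have hw1 : ‖1 + w‖ ≠ 0 := norm_ne_zero_iff.mpr (one_add_ne_zero_of_mem_ball hw)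
  rw [im_discPoint hw, discE₄, norm_div, norm_pow, mul_pow, div_pow, div_pow,
    Real.sq_sqrt zero_le_three]
  field_simp
  norm_num
  ring

end DiscCoordinate

section NumericalBounds

lemma exp_le_taylor {x : ℝ} (h0 : 0 ≤ x) (h1 : x ≤ 1) :
    Real.exp x ≤ 1 + x + x ^ 2 / 2 + x ^ 3 / 6 + x ^ 4 * (5 / 96) := by
  have h := Real.exp_bound' h0 h1 (n := 4) (by norm_num)
  norm_num [Finset.sum_range_succ, Nat.factorial] at h
  linarith

lemma taylor_le_exp {x : ℝ} (h0 : 0 ≤ x) :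
    1 + x + x ^ 2 / 2 + x ^ 3 / 6 + x ^ 4 / 24 ≤ Real.exp x := by
  have h := Real.sum_le_exp_of_nonneg h0 5
  norm_num [Finset.sum_range_succ, Nat.factorial] at h
  linarith

-- Quartering the fractional part of the exponent makes the quartic Taylor polynomial precise.
lemma exp_le_of_le_natCast_add_four_mul {x : ℝ} (n : ℕ) (u : ℝ) (hx : x ≤ n + 4 * u) (h0 : 0 ≤ u)
    (h1 : u ≤ 1) :
    Real.exp x ≤ 2.7182818286 ^ n * (1 + u + u ^ 2 / 2 + u ^ 3 / 6 + u ^ 4 * (5 / 96)) ^ 4 :=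
  calc Real.exp x ≤ Real.exp (n * 1 + (4 : ℕ) * u) := by
        gcongr
        simpa using hx
    _ = Real.exp 1 ^ n * Real.exp u ^ 4 := by rw [Real.exp_add, Real.exp_nat_mul, Real.exp_nat_mul]
    _ ≤ _ := by
        gcongr
        · exact Real.exp_one_lt_d9.le
        · exact exp_le_taylor h0 h1

lemma le_exp_of_natCast_add_four_mul_le {x : ℝ} (n : ℕ) (u : ℝ) (hx : n + 4 * u ≤ x)
    (h0 : 0 ≤ u) :
    2.7182818283 ^ n * (1 + u + u ^ 2 / 2 + u ^ 3 / 6 + u ^ 4 / 24) ^ 4 ≤ Real.exp x :=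
  calc _ ≤ Real.exp 1 ^ n * Real.exp u ^ 4 := by
        gcongr
        · exact Real.exp_one_gt_d9.le
        · exact taylor_le_exp h0
    _ = Real.exp (n * 1 + (4 : ℕ) * u) := by rw [Real.exp_add, Real.exp_nat_mul, Real.exp_nat_mul]
    _ ≤ Real.exp x := by
        gcongr
        simpa using hx

lemma exp_neg_le_of_inv_le_exp {x c : ℝ} (hc : 0 < c) (h : c⁻¹ ≤ Real.exp x) :
    Real.exp (-x) ≤ c := by
  rwa [Real.exp_neg, inv_le_comm₀ (Real.exp_pos _) hc]

lemma le_exp_neg_of_exp_le_inv {x c : ℝ} (hc : 0 < c) (h : Real.exp x ≤ c⁻¹) :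
    c ≤ Real.exp (-x) := by
  rwa [Real.exp_neg, le_inv_comm₀ hc (Real.exp_pos _)]

lemma neg_le_log_of_inv_le_exp {x c : ℝ} (hc : 0 < c) (h : c⁻¹ ≤ Real.exp x) :
    -x ≤ Real.log c :=
  (Real.le_log_iff_exp_le hc).mpr (exp_neg_le_of_inv_le_exp hc h)

lemma log_le_neg_of_exp_le_inv {x c : ℝ} (hc : 0 < c) (h : Real.exp x ≤ c⁻¹) :
    Real.log c ≤ -x :=
  (Real.log_le_iff_le_exp hc).mpr (le_exp_neg_of_exp_le_inv hc h)

lemma log_three_div_four_bounds :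
    -0.2877 ≤ Real.log (3 / 4) ∧ Real.log (3 / 4) ≤ -0.2876 := by
  constructor
  · exact neg_le_log_of_inv_le_exp (by norm_num) (le_trans (by norm_num)
      (le_exp_of_natCast_add_four_mul_le 0 0.071925 (by norm_num) (by norm_num)))
  · exact log_le_neg_of_exp_le_inv (by norm_num) ((exp_le_of_le_natCast_add_four_mul 0 0.0719
      (by norm_num) (by norm_num) (by norm_num)).trans (by norm_num))

lemma sqrt_three_bounds : 1.73205 < √3 ∧ √3 < 1.732051 :=
  ⟨Real.lt_sqrt_of_sq_lt (by norm_num), (Real.sqrt_lt' (by norm_num)).mpr (by norm_num)⟩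

lemma pi_mul_sqrt_three_bounds : 5.44139 < Real.pi * √3 ∧ Real.pi * √3 < 5.441405 := by
  obtain ⟨hsqrt_gt, hsqrt_lt⟩ := sqrt_three_bounds
  have hpi_gt := Real.pi_gt_d6
  have hpi_lt := Real.pi_lt_d6
  constructor <;> nlinarith

lemma exp_neg_pi_mul_sqrt_three_bounds :
    0.00433 ≤ Real.exp (-(Real.pi * √3)) ∧ Real.exp (-(Real.pi * √3)) ≤ 0.00434 := by
  obtain ⟨hgt, hlt⟩ := pi_mul_sqrt_three_bounds
  constructor
  · exact le_exp_neg_of_exp_le_inv (by norm_num) ((exp_le_of_le_natCast_add_four_mul 5 0.11036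
      (by norm_num; linarith) (by norm_num) (by norm_num)).trans (by norm_num))
  · exact exp_neg_le_of_inv_le_exp (by norm_num) (le_trans (by norm_num)
      (le_exp_of_natCast_add_four_mul_le 5 0.1103 (by norm_num; linarith) (by norm_num)))

lemma log_le_log_add_div_sub_one {x a : ℝ} (hx : 0 < x) (ha : 0 < a) :
    Real.log x ≤ Real.log a + x / a - 1 := by
  have h := Real.log_le_sub_one_of_pos (div_pos hx ha)
  rw [Real.log_div hx.ne' ha.ne'] at h
  linarith

lemma div_one_sub_le_div_one_sub {x y : ℝ} (hxy : x ≤ y) (hy : y < 1) :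
    x / (1 - x) ≤ y / (1 - y) := by
  rw [div_le_div_iff₀ (by linarith) (by linarith)]
  nlinarith

lemma exp_neg_div_one_sub_le_one_sub {x t : ℝ} (hx : 0 ≤ x) (hxt : x ≤ t) (ht : t < 1) :
    Real.exp (-(x / (1 - t))) ≤ 1 - x := by
  have hx1 : 0 < 1 - x := by linarith
  have hle : x / (1 - x) ≤ x / (1 - t) := by
    gcongr
  rw [Real.exp_neg, inv_le_comm₀ (Real.exp_pos _) hx1]
  calc (1 - x)⁻¹ = x / (1 - x) + 1 := by
        field_simp
        ring
    _ ≤ x / (1 - t) + 1 := by gcongr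
    _ ≤ Real.exp (x / (1 - t)) := Real.add_one_le_exp _

end NumericalBounds

section DiscriminantBounds

open Function.Periodic

/-- The absolute value of the nome `q = exp (2πiτ)`. -/
noncomputable def qAbs (τ : ℍ) : ℝ := Real.exp (-(2 * Real.pi * τ.im))

variable {τ : ℍ}

lemma qAbs_pos (τ : ℍ) : 0 < qAbs τ := Real.exp_pos _

lemma qAbs_lt_one (τ : ℍ) : qAbs τ < 1 :=
  Real.exp_lt_one_iff.mpr (neg_lt_zero.mpr (mul_pos Real.two_pi_pos τ.im_pos))

lemma one_sub_qAbs_pos (τ : ℍ) : 0 < 1 - qAbs τ := sub_pos.mpr (qAbs_lt_one τ)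

lemma qAbs_le_of_le_im {y : ℝ} (h : y ≤ τ.im) : qAbs τ ≤ Real.exp (-(2 * Real.pi * y)) := by
  rw [qAbs]
  gcongr

lemma norm_qParam_one (τ : ℍ) : ‖qParam 1 τ‖ = qAbs τ := by
  rw [norm_qParam, qAbs, coe_im]
  congr 1
  ring

lemma norm_one_sub_qParam_pow_le (τ : ℍ) (n : ℕ) :
    ‖1 - qParam 1 τ ^ n‖ ≤ Real.exp (qAbs τ ^ n) :=
  calc ‖1 - qParam 1 τ ^ n‖ ≤ 1 + qAbs τ ^ n := by
        simpa only [norm_one, norm_pow, norm_qParam_one] using norm_sub_le (1 : ℂ) (qParam 1 τ ^ n)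
    _ ≤ Real.exp (qAbs τ ^ n) := by
        rw [add_comm]
        exact Real.add_one_le_exp _

lemma exp_neg_le_norm_one_sub_qParam_pow (τ : ℍ) {n : ℕ} (hn : n ≠ 0) :
    Real.exp (-(qAbs τ ^ n / (1 - qAbs τ))) ≤ ‖1 - qParam 1 τ ^ n‖ :=
  have hpos := qAbs_pos τ
  calc Real.exp (-(qAbs τ ^ n / (1 - qAbs τ))) ≤ 1 - qAbs τ ^ n :=
        exp_neg_div_one_sub_le_one_sub (by positivity)
          (pow_le_of_le_one hpos.le (qAbs_lt_one τ).le hn) (qAbs_lt_one τ)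
    _ ≤ ‖1 - qParam 1 τ ^ n‖ := by
        simpa only [norm_one, norm_pow, norm_qParam_one] using
          norm_sub_norm_le (1 : ℂ) (qParam 1 τ ^ n)

lemma hasSum_qAbs_pow_add (τ : ℍ) (k : ℕ) :
    HasSum (fun n ↦ qAbs τ ^ (n + k)) (qAbs τ ^ k / (1 - qAbs τ)) := by
  simpa [pow_add, mul_comm, div_eq_mul_inv] using
    (hasSum_geometric_of_lt_one (qAbs_pos τ).le (qAbs_lt_one τ)).mul_left (qAbs τ ^ k)

lemma tendsto_prod_discriminant (τ : ℍ) :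
    Tendsto (fun n ↦ qAbs τ * ∏ i ∈ Finset.range n, ‖1 - qParam 1 τ ^ (i + 1)‖ ^ 24) atTop
      (𝓝 ‖discriminant τ‖) := by
  have hmult := (multipliableLocallyUniformlyOn_eta.multipliable τ.2).pow 24
  have htendsto := hmult.hasProd.tendsto_prod_nat.norm.const_mul ‖qParam 1 (τ : ℂ)‖
  rw [← norm_mul, ← discriminant_eq_q_prod, norm_qParam_one] at htendsto
  refine htendsto.congr fun n ↦ ?_
  simp only [norm_prod, norm_pow, eta_q]

lemma norm_discriminant_le (τ : ℍ) :
    ‖discriminant τ‖ ≤ Real.exp (-(2 * Real.pi * τ.im) + 24 * (qAbs τ / (1 - qAbs τ))) := by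
  have hpos := qAbs_pos τ
  refine le_of_tendsto (tendsto_prod_discriminant τ) (Eventually.of_forall fun n ↦ ?_)
  rw [Real.exp_add, ← qAbs]
  gcongr
  calc ∏ i ∈ Finset.range n, ‖1 - qParam 1 τ ^ (i + 1)‖ ^ 24
      ≤ ∏ i ∈ Finset.range n, Real.exp (qAbs τ ^ (i + 1)) ^ 24 := by
        gcongr
        exact norm_one_sub_qParam_pow_le τ _
    _ = Real.exp (24 * ∑ i ∈ Finset.range n, qAbs τ ^ (i + 1)) := by
        rw [Finset.prod_pow, ← Real.exp_sum, ← Real.exp_nat_mul, Nat.cast_ofNat]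
    _ ≤ Real.exp (24 * (qAbs τ / (1 - qAbs τ))) := by
        gcongr
        simpa using sum_le_hasSum (Finset.range n) (fun _ _ ↦ by positivity)
          (hasSum_qAbs_pow_add τ 1)

-- The first factor is kept exact: it carries the leading correction to `log ‖Δ‖`.
lemma le_norm_discriminant (τ : ℍ) :
    qAbs τ * ‖1 - qParam 1 τ‖ ^ 24 * Real.exp (-(24 * (qAbs τ / (1 - qAbs τ)) ^ 2)) ≤
      ‖discriminant τ‖ := by
  have hpos := qAbs_pos τ
  have hsub := one_sub_qAbs_pos τ
  refine ge_of_tendsto ((tendsto_add_atTop_iff_nat 1).mpr (tendsto_prod_discriminant τ))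
    (Eventually.of_forall fun n ↦ ?_)
  rw [Finset.prod_range_succ', zero_add, pow_one, mul_assoc, mul_comm (∏ i ∈ Finset.range n, _)]
  gcongr
  calc Real.exp (-(24 * (qAbs τ / (1 - qAbs τ)) ^ 2))
      = Real.exp (24 * -(qAbs τ ^ 2 / (1 - qAbs τ) / (1 - qAbs τ))) := by
        congr 1
        field_simp
    _ ≤ Real.exp (24 * ∑ i ∈ Finset.range n, -(qAbs τ ^ (i + 2) / (1 - qAbs τ))) := by
        rw [Finset.sum_neg_distrib, ← Finset.sum_div]
        gcongr
        exact sum_le_hasSum _ (fun _ _ ↦ by positivity) (hasSum_qAbs_pow_add τ 2)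
    _ = ∏ i ∈ Finset.range n, Real.exp (-(qAbs τ ^ (i + 2) / (1 - qAbs τ))) ^ 24 := by
        rw [Finset.prod_pow, ← Real.exp_sum, ← Real.exp_nat_mul, Nat.cast_ofNat]
    _ ≤ ∏ i ∈ Finset.range n, ‖1 - qParam 1 τ ^ (i + 1 + 1)‖ ^ 24 := by
        gcongr
        exact exp_neg_le_norm_one_sub_qParam_pow τ (by positivity)

lemma log_norm_discriminant_le (τ : ℍ) :
    Real.log ‖discriminant τ‖ ≤ -(2 * Real.pi * τ.im) + 24 * (qAbs τ / (1 - qAbs τ)) :=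
  (Real.log_le_iff_le_exp (norm_pos_iff.mpr (discriminant_ne_zero τ))).mpr (norm_discriminant_le τ)

lemma qParam_of_re_eq_neg_half (h : τ.re = -1 / 2) : qParam 1 τ = -(qAbs τ : ℂ) := by
  have hτ : (τ : ℂ) = -1 / 2 + τ.im * Complex.I := by
    apply Complex.ext <;> simp [h]
  have hexponent : 2 * Real.pi * Complex.I * (-1 / 2 + τ.im * Complex.I) / (1 : ℝ) =
      ((-(2 * Real.pi * τ.im) : ℝ) : ℂ) - Real.pi * Complex.I := by
    push_cast
    linear_combination (2 * Real.pi * τ.im : ℂ) * Complex.I_sq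
  rw [qParam, hτ, qAbs, hexponent, Complex.exp_sub, Complex.exp_pi_mul_I, div_neg, div_one,
    ← Complex.ofReal_exp]

lemma le_log_norm_discriminant (h : τ.re = -1 / 2) :
    -(2 * Real.pi * τ.im) + 24 * (qAbs τ / (1 + qAbs τ)) - 24 * (qAbs τ / (1 - qAbs τ)) ^ 2 ≤
      Real.log ‖discriminant τ‖ := by
  have hpos := qAbs_pos τ
  have hfactor : ‖1 - qParam 1 τ‖ = 1 + qAbs τ := by
    rw [qParam_of_re_eq_neg_half h, sub_neg_eq_add, ← Complex.ofReal_one, ← Complex.ofReal_add,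
      Complex.norm_of_nonneg (by positivity)]
  have hlog : qAbs τ / (1 + qAbs τ) ≤ Real.log (1 + qAbs τ) := by
    convert Real.one_sub_inv_le_log_of_pos (show 0 < 1 + qAbs τ by positivity) using 1
    field_simp
    ring
  have hle := Real.log_le_log (by rw [hfactor]; positivity) (le_norm_discriminant τ)
  rw [hfactor, Real.log_mul (by positivity) (by positivity),
    Real.log_mul (by positivity) (by positivity), Real.log_pow, Real.log_exp, Nat.cast_ofNat] at hle
  have hq : Real.log (qAbs τ) = -(2 * Real.pi * τ.im) := by rw [qAbs, Real.log_exp]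
  linarith

lemma ρ_re : (ρ : ℍ).re = -1 / 2 := rfl

lemma ρ_im : (ρ : ℍ).im = √3 / 2 := rfl

lemma two_pi_mul_ρ_im : 2 * Real.pi * (ρ : ℍ).im = Real.pi * √3 := by
  rw [ρ_im]
  ring

lemma qAbs_ρ_bounds : 0.00433 ≤ qAbs ρ ∧ qAbs ρ ≤ 0.00434 := by
  rw [qAbs, two_pi_mul_ρ_im]
  exact exp_neg_pi_mul_sqrt_three_bounds

lemma log_norm_discriminant_ρ_bounds :
    -5.3385 ≤ Real.log ‖discriminant ρ‖ ∧ Real.log ‖discriminant ρ‖ ≤ -5.3365 := by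
  obtain ⟨hpi_gt, hpi_lt⟩ := pi_mul_sqrt_three_bounds
  obtain ⟨hq_ge, hq_le⟩ := qAbs_ρ_bounds
  have him := two_pi_mul_ρ_im
  have hminus : qAbs ρ / (1 - qAbs ρ) ≤ 0.00436 :=
    (div_one_sub_le_div_one_sub hq_le (by norm_num)).trans (by norm_num)
  constructor
  · have hplus : 0.00431 ≤ qAbs ρ / (1 + qAbs ρ) := by
      rw [le_div_iff₀ (by linarith)]
      linarith
    have hsq : (qAbs ρ / (1 - qAbs ρ)) ^ 2 ≤ 0.00436 ^ 2 := by
      gcongr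
      exact (div_pos (qAbs_pos ρ) (one_sub_qAbs_pos ρ)).le
    linarith [le_log_norm_discriminant ρ_re]
  · linarith [log_norm_discriminant_le ρ]

end DiscriminantBounds

section EisensteinBounds

variable {τ : ℍ}

lemma norm_sigma_mul_pow_le {z : ℂ} (n : ℕ+) :
    ‖(ArithmeticFunction.sigma 3 n : ℂ) * z ^ (n : ℤ)‖ ≤ ‖z‖ * (16 * ‖z‖) ^ n.natPred := by
  obtain ⟨m, rfl⟩ : ∃ m : ℕ, m.succPNat = n := ⟨n.natPred, n.succPNat_natPred⟩
  have hsigma : ArithmeticFunction.sigma 3 (m + 1) ≤ 16 ^ m :=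
    calc ArithmeticFunction.sigma 3 (m + 1) ≤ (m + 1) ^ (3 + 1) :=
          ArithmeticFunction.sigma_le_pow_succ 3 (m + 1)
      _ ≤ (2 ^ m) ^ 4 := Nat.pow_le_pow_left Nat.lt_two_pow_self 4
      _ = 16 ^ m := by rw [← pow_mul, mul_comm m 4, pow_mul]; rfl
  rw [norm_mul, zpow_natCast, norm_pow, Nat.natPred_succPNat, Nat.succPNat_coe, Nat.succ_eq_add_one,
    Complex.norm_natCast]
  calc _ ≤ (16 : ℝ) ^ m * ‖z‖ ^ (m + 1) := by
        gcongr
        exact_mod_cast hsigma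
    _ = ‖z‖ * (16 * ‖z‖) ^ m := by ring

lemma norm_tsum_sigma_mul_pow_le {z : ℂ} (h : 16 * ‖z‖ < 1) :
    ‖∑' n : ℕ+, (ArithmeticFunction.sigma 3 n : ℂ) * z ^ (n : ℤ)‖ ≤ ‖z‖ / (1 - 16 * ‖z‖) := by
  have hgeom := (hasSum_geometric_of_lt_one (by positivity) h).mul_left ‖z‖
  rw [← div_eq_mul_inv] at hgeom
  exact tsum_of_norm_bounded ((Equiv.hasSum_iff Equiv.pnatEquivNat).mpr hgeom) norm_sigma_mul_pow_le

lemma E₄_eq_one_add_tsum (τ : ℍ) :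
    E₄ τ = 1 + 240 * ∑' n : ℕ+, (ArithmeticFunction.sigma 3 n : ℂ) *
      Complex.exp (2 * Real.pi * Complex.I * τ) ^ (n : ℤ) := by
  rw [EisensteinSeries.q_expansion_bernoulli _ ⟨2, rfl⟩,
    show bernoulli 4 = -1 / 30 by decide +kernel]
  norm_num

lemma norm_E₄_sub_one_le {q : ℝ} (hq : qAbs τ ≤ q) (hq1 : 16 * q < 1) :
    ‖E₄ τ - 1‖ ≤ 240 * (q / (1 - 16 * q)) := by
  have hexp : ‖Complex.exp (2 * Real.pi * Complex.I * τ)‖ = qAbs τ := by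
    simpa [Function.Periodic.qParam] using norm_qParam_one τ
  have htsum := norm_tsum_sigma_mul_pow_le (hexp ▸ (by linarith) :
    16 * ‖Complex.exp (2 * Real.pi * Complex.I * τ)‖ < 1)
  rw [E₄_eq_one_add_tsum, add_sub_cancel_left, norm_mul, Complex.norm_ofNat]
  gcongr
  calc _ ≤ qAbs τ / (1 - 16 * qAbs τ) := hexp ▸ htsum
    _ ≤ q / (1 - 16 * q) := by
        have := qAbs_pos τ
        gcongr
        linarith

lemma norm_E₄_le {q : ℝ} (hq : qAbs τ ≤ q) (hq1 : 16 * q < 1) :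
    ‖E₄ τ‖ ≤ 1 + 240 * (q / (1 - 16 * q)) := by
  have h := (norm_sub_norm_le (E₄ τ) 1).trans (norm_E₄_sub_one_le hq hq1)
  rwa [norm_one, sub_le_iff_le_add'] at h

end EisensteinBounds

section PeterssonNorm

/-- The logarithm of the invariant function `y⁶ ‖Δ‖`. -/
noncomputable def logPetersson (τ : ℍ) : ℝ := Real.log (τ.im ^ 6 * ‖discriminant τ‖)

variable {τ : ℍ}

lemma logPetersson_eq (τ : ℍ) :
    logPetersson τ = 6 * Real.log τ.im + Real.log ‖discriminant τ‖ := by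
  rw [logPetersson, Real.log_mul (pow_ne_zero _ τ.im_ne_zero)
    (norm_ne_zero_iff.mpr (discriminant_ne_zero τ)), Real.log_pow, Nat.cast_ofNat]

lemma gInfty_eq_sub_logPetersson (τ : ℍ) :
    gInfty τ = -(6 * Real.log (4 * Real.pi)) - logPetersson τ := by
  have hΔ := norm_ne_zero_iff.mpr (discriminant_ne_zero τ)
  rw [gInfty, mul_pow, mul_assoc, Real.log_mul (by positivity) (by positivity), Real.log_pow,
    logPetersson, Nat.cast_ofNat]
  ring

lemma logPetersson_smul (γ : SL(2, ℤ)) (τ : ℍ) : logPetersson (γ • τ) = logPetersson τ := by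
  have h := gInfty_smul γ τ
  rw [gInfty_eq_sub_logPetersson, gInfty_eq_sub_logPetersson] at h
  linarith

lemma sqrt_three_div_two_le_im_of_mem_fd (h : τ ∈ 𝒟) : √3 / 2 ≤ τ.im := by
  have hsq := ModularGroup.three_le_four_mul_im_sq_of_mem_fd h
  have hsqrt : √3 ≤ 2 * τ.im := Real.sqrt_le_iff.mpr ⟨by positivity, by nlinarith⟩
  linarith

lemma qAbs_le_of_mem_fd (h : τ ∈ 𝒟) : qAbs τ ≤ 0.00434 :=
  (qAbs_le_of_le_im (sqrt_three_div_two_le_im_of_mem_fd h)).trans qAbs_ρ_bounds.2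

lemma log_point_955_le : Real.log 0.955 ≤ -0.046 :=
  log_le_neg_of_exp_le_inv (by norm_num) ((exp_le_of_le_natCast_add_four_mul 0 0.0115
    (by norm_num) (by norm_num) (by norm_num)).trans (by norm_num))

-- `y⁶ exp (-2πy)` is largest at `y = 3 / π ≈ 0.955`, hence the choice of tangent to the logarithm.
lemma logPetersson_le_add (τ : ℍ) :
    logPetersson τ ≤ 3 * Real.log (3 / 4) + Real.log ‖discriminant ρ‖ + 0.035 := by
  obtain ⟨γ, hγ⟩ := ModularGroup.exists_smul_mem_fd τ
  rw [← logPetersson_smul γ, logPetersson_eq]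
  set z := γ • τ
  have hlog := log_le_log_add_div_sub_one z.im_pos (a := 0.955) (by norm_num)
  have him : 6 * (z.im / 0.955) ≤ 2 * Real.pi * z.im := by
    have := Real.pi_gt_d6
    have := z.im_pos
    rw [mul_div_assoc', div_le_iff₀ (by norm_num)]
    nlinarith
  have hq : qAbs z / (1 - qAbs z) ≤ 0.00436 :=
    (div_one_sub_le_div_one_sub (qAbs_le_of_mem_fd hγ) (by norm_num)).trans (by norm_num)
  linarith [log_norm_discriminant_le z, log_point_955_le, log_three_div_four_bounds.1,
    log_norm_discriminant_ρ_bounds.1]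

end PeterssonNorm

section DeltaLogarithm

variable {w s : ℂ} {x : ℝ}

lemma logPetersson_discPoint (hw : w ∈ ball (0 : ℂ) 1) :
    logPetersson (discPoint w) =
      3 * Real.log (3 / 4) + 6 * Real.log (1 - ‖w‖ ^ 2) + Real.log ‖deltaHat (w ^ 3)‖ := by
  have hδ : ‖deltaHat (w ^ 3)‖ ≠ 0 :=
    norm_ne_zero_iff.mpr (deltaHat_ne_zero (pow_three_mem_ball_iff.mpr hw))
  have hpos := one_sub_sq_norm_pos hw
  rw [logPetersson, im_pow_six_mul_norm_discriminant_discPoint hw, Real.log_mul (by norm_num)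
    (by positivity), Real.log_mul (by positivity) hδ, Real.log_pow,
    show (27 / 64 : ℝ) = (3 / 4) ^ 3 by norm_num, Real.log_pow]
  push_cast
  ring

/-- The logarithm of `deltaHat / deltaHat 0` on the unit disc that vanishes at the origin. -/
noncomputable def deltaLog : ℂ → ℂ :=
  (exists_differentiableOn_mul_cexp_eq differentiableOn_deltaHat
    fun _ ↦ deltaHat_ne_zero).choose

lemma differentiableOn_deltaLog : DifferentiableOn ℂ deltaLog (ball 0 1) :=
  (exists_differentiableOn_mul_cexp_eq differentiableOn_deltaHat
    fun _ ↦ deltaHat_ne_zero).choose_spec.1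

lemma deltaLog_zero : deltaLog 0 = 0 :=
  (exists_differentiableOn_mul_cexp_eq differentiableOn_deltaHat
    fun _ ↦ deltaHat_ne_zero).choose_spec.2.1

lemma deltaHat_zero_mul_exp_deltaLog (hs : s ∈ ball (0 : ℂ) 1) :
    deltaHat 0 * Complex.exp (deltaLog s) = deltaHat s :=
  (exists_differentiableOn_mul_cexp_eq differentiableOn_deltaHat
    fun _ ↦ deltaHat_ne_zero).choose_spec.2.2 s hs

lemma deltaLog_conj (hs : s ∈ ball (0 : ℂ) 1) : deltaLog (conj s) = conj (deltaLog s) :=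
  log_conj_of_mul_cexp_eq differentiableOn_deltaLog deltaLog_zero
    (deltaHat_ne_zero (mem_ball_self one_pos)) (fun _ ↦ deltaHat_zero_mul_exp_deltaLog)
    (fun _ ↦ deltaHat_conj) hs

lemma log_norm_deltaHat (hs : s ∈ ball (0 : ℂ) 1) :
    Real.log ‖deltaHat s‖ = Real.log ‖discriminant ρ‖ + (deltaLog s).re := by
  rw [← deltaHat_zero_mul_exp_deltaLog hs, norm_mul, deltaHat_zero, Complex.norm_exp,
    Real.log_mul (norm_ne_zero_iff.mpr (discriminant_ne_zero ρ)) (Real.exp_ne_zero _), Real.log_exp]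

lemma re_deltaLog_le (hs : s ∈ ball (0 : ℂ) (8 / 27)) : (deltaLog s).re ≤ 3.57 := by
  have hs1 : s ∈ ball (0 : ℂ) 1 := ball_subset_ball (by norm_num) hs
  obtain ⟨w, hw, rfl⟩ := exists_mem_ball_pow_three_eq hs1
  have heq := logPetersson_discPoint hw
  rw [log_norm_deltaHat hs1] at heq
  have hnorm : ‖w‖ < 2 / 3 := by
    rw [mem_ball_zero_iff, norm_pow] at hs
    exact lt_of_pow_lt_pow_left₀ 3 (by norm_num) (hs.trans_eq (by norm_num))
  have hlog : Real.log (5 / 9) ≤ Real.log (1 - ‖w‖ ^ 2) :=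
    Real.log_le_log (by norm_num) (by nlinarith [norm_nonneg w])
  have hlog_five_div_nine : -0.588 ≤ Real.log (5 / 9) :=
    neg_le_log_of_inv_le_exp (by norm_num) (le_trans (by norm_num)
      (le_exp_of_natCast_add_four_mul_le 0 0.147 (by norm_num) (by norm_num)))
  linarith [logPetersson_le_add (discPoint w)]

lemma norm_deltaLog_le (hs : s ∈ ball (0 : ℂ) (8 / 27)) :
    ‖deltaLog s‖ ≤ 2 * 3.57 * ‖s‖ / (8 / 27 - ‖s‖) :=
  Complex.borelCaratheodory_zero (by norm_num)
    (differentiableOn_deltaLog.mono (ball_subset_ball (by norm_num)))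
    (fun _ ↦ re_deltaLog_le) (by norm_num) hs deltaLog_zero

lemma isRealBoundedOnBall_deltaLog : IsRealBoundedOnBall deltaLog (1 / 8) 5.25 where
  differentiableOn := differentiableOn_deltaLog.mono (ball_subset_ball (by norm_num))
  map_zero := deltaLog_zero
  map_conj _ hz := deltaLog_conj (ball_subset_ball (by norm_num) hz)
  norm_le z hz := by
    refine (norm_deltaLog_le (ball_subset_ball (by norm_num) hz)).trans ?_
    rw [mem_ball_zero_iff] at hz
    rw [div_le_iff₀ (by linarith)]
    linarith

lemma norm_deltaLog_le_mul_norm (hs : s ∈ ball (0 : ℂ) (1 / 110)) : ‖deltaLog s‖ ≤ 26 * ‖s‖ := by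
  refine (norm_deltaLog_le (ball_subset_ball (by norm_num) hs)).trans ?_
  rw [mem_ball_zero_iff] at hs
  rw [div_le_iff₀ (by linarith)]
  nlinarith [norm_nonneg s]

lemma ofReal_mem_ball_zero_iff {R : ℝ} : (x : ℂ) ∈ ball (0 : ℂ) R ↔ |x| < R := by
  rw [mem_ball_zero_iff, Complex.norm_real, Real.norm_eq_abs]

lemma norm_one_add_ofReal (hx : |x| < 1) : ‖(1 : ℂ) + x‖ = 1 + x := by
  rw [← Complex.ofReal_one, ← Complex.ofReal_add, Complex.norm_of_nonneg]
  linarith [(abs_lt.mp hx).1]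

lemma re_discPoint_ofReal (hx : |x| < 1) : (discPoint x).re = -1 / 2 := by
  have hne : (1 : ℝ) + x ≠ 0 := by linarith [(abs_lt.mp hx).1]
  have hdiscTau : discTau x = (((1 + x)⁻¹ : ℝ) : ℂ) * (ρ + conj (ρ : ℂ) * x) := by
    rw [discTau]
    push_cast
    rw [div_eq_inv_mul]
  rw [← coe_re, coe_discPoint (ofReal_mem_ball_zero_iff.mpr hx), hdiscTau, Complex.re_ofReal_mul]
  simp only [Complex.add_re, Complex.mul_re, Complex.conj_re, Complex.ofReal_re,
    Complex.ofReal_im, coe_re, ρ_re]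
  field_simp
  ring

lemma two_pi_mul_im_discPoint_ofReal (hx : |x| < 1) :
    2 * Real.pi * (discPoint x).im = (1 - x) / (1 + x) * (Real.pi * √3) := by
  have hne : (1 : ℝ) + x ≠ 0 := by linarith [(abs_lt.mp hx).1]
  rw [im_discPoint (ofReal_mem_ball_zero_iff.mpr hx), norm_one_add_ofReal hx, Complex.norm_real,
    Real.norm_eq_abs, sq_abs]
  field_simp
  ring

lemma re_deltaLog_ofReal_pow_three (hx : |x| < 1) :
    (deltaLog ((x : ℂ) ^ 3)).re =
      Real.log ‖discriminant (discPoint x)‖ - 12 * Real.log (1 + x) -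
        Real.log ‖discriminant ρ‖ := by
  have hball := ofReal_mem_ball_zero_iff.mpr hx
  have hpos : 0 < 1 + x := by linarith [(abs_lt.mp hx).1]
  have hlog := log_norm_deltaHat (pow_three_mem_ball_iff.mpr hball)
  rw [deltaHat_pow hball, discDelta, norm_div, norm_pow, norm_one_add_ofReal hx, Real.log_div
    (norm_ne_zero_iff.mpr (discriminant_ne_zero _)) (by positivity), Real.log_pow,
    Nat.cast_ofNat] at hlog
  linarith

lemma log_four_div_five_bounds :
    -0.22315 ≤ Real.log (4 / 5) ∧ Real.log (4 / 5) ≤ -0.22314 := by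
  constructor
  · exact neg_le_log_of_inv_le_exp (by norm_num) (le_trans (by norm_num)
      (le_exp_of_natCast_add_four_mul_le 0 0.0557875 (by norm_num) (by norm_num)))
  · exact log_le_neg_of_exp_le_inv (by norm_num) ((exp_le_of_le_natCast_add_four_mul 0 0.055785
      (by norm_num) (by norm_num) (by norm_num)).trans (by norm_num))

lemma re_deltaLog_neg_one_div_five_pow_three_bounds :
    -0.148 ≤ (deltaLog (((-1 / 5 : ℝ) : ℂ) ^ 3)).re ∧
      (deltaLog (((-1 / 5 : ℝ) : ℂ) ^ 3)).re ≤ -0.1388 := by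
  have hx : |(-1 / 5 : ℝ)| < 1 := by
    rw [abs_lt]
    norm_num
  obtain ⟨hpi_gt, hpi_lt⟩ := pi_mul_sqrt_three_bounds
  have hlower := le_log_norm_discriminant (re_discPoint_ofReal hx)
  have hupper := log_norm_discriminant_le (discPoint (-1 / 5 : ℝ))
  have him : 2 * Real.pi * (discPoint (-1 / 5 : ℝ)).im = 3 / 2 * (Real.pi * √3) :=
    (two_pi_mul_im_discPoint_ofReal hx).trans (by norm_num)
  rw [re_deltaLog_ofReal_pow_three hx, show (1 + -1 / 5 : ℝ) = 4 / 5 by norm_num]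
  have hq : qAbs (discPoint (-1 / 5 : ℝ)) ≤ 0.000287 := by
    rw [qAbs, him]
    exact exp_neg_le_of_inv_le_exp (by norm_num) (le_trans (by norm_num)
      (le_exp_of_natCast_add_four_mul_le 8 0.04 (by norm_num; linarith) (by norm_num)))
  have hpos := qAbs_pos (discPoint (-1 / 5 : ℝ))
  set t := qAbs (discPoint (-1 / 5 : ℝ))
  have hminus : t / (1 - t) ≤ 0.00028709 :=
    (div_one_sub_le_div_one_sub hq (by norm_num)).trans (by norm_num)
  have hcompare : (t / (1 - t)) ^ 2 ≤ t / (1 + t) := by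
    have : 0 < 1 - t := by linarith
    rw [div_pow, div_le_div_iff₀ (by positivity) (by positivity)]
    nlinarith
  obtain ⟨hlog_ge, hlog_le⟩ := log_four_div_five_bounds
  obtain ⟨hρ_ge, hρ_le⟩ := log_norm_discriminant_ρ_bounds
  constructor <;> linarith

lemma realTaylorCoeff_deltaLog_one_bounds :
    14 ≤ realTaylorCoeff deltaLog 1 ∧ realTaylorCoeff deltaLog 1 ≤ 21.5 := by
  have hnorm : ‖((-1 / 5 : ℝ) : ℂ) ^ 3‖ = 1 / 125 := by
    rw [norm_pow, Complex.norm_real]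
    norm_num
  have hre : (((-1 / 5 : ℝ) : ℂ) ^ 3).re = -1 / 125 := by
    rw [← Complex.ofReal_pow, Complex.ofReal_re]
    norm_num
  have hlinear := isRealBoundedOnBall_deltaLog.abs_re_sub_linear_le
    (s := ((-1 / 5 : ℝ) : ℂ) ^ 3) (by rw [mem_ball_zero_iff, hnorm]; norm_num)
  obtain ⟨hge, hle⟩ := re_deltaLog_neg_one_div_five_pow_three_bounds
  rw [hnorm, hre, abs_le] at hlinear
  norm_num at hlinear hge hle ⊢
  constructor <;> linarith

end DeltaLogarithm

section EisensteinLogarithm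

variable {w s : ℂ} {τ : ℍ}

lemma im_sq_mul_norm_E₄_smul (γ : SL(2, ℤ)) (τ : ℍ) :
    (γ • τ).im ^ 2 * ‖E₄ (γ • τ)‖ = τ.im ^ 2 * ‖E₄ τ‖ := by
  have hdenom : ‖denom γ τ‖ ≠ 0 := norm_ne_zero_iff.mpr (denom_ne_zero γ τ)
  rw [E₄_smul, ModularGroup.im_smul_eq_div_normSq, Complex.normSq_eq_norm_sq, norm_mul, norm_pow]
  field_simp

lemma normSq_denom_ρ (γ : SL(2, ℤ)) :
    Complex.normSq (denom γ ρ) = ((γ 1 0 ^ 2 - γ 1 0 * γ 1 1 + γ 1 1 ^ 2 : ℤ) : ℝ) := by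
  have hsq : √3 ^ 2 = 3 := Real.sq_sqrt (by norm_num)
  rw [ModularGroup.denom_apply, Complex.normSq_apply]
  simp only [Complex.add_re, Complex.add_im, Complex.mul_re, Complex.mul_im, Complex.intCast_re,
    Complex.intCast_im, coe_re, coe_im, ρ_re, ρ_im]
  push_cast
  linear_combination (γ 1 0 : ℝ) ^ 2 / 4 * hsq

lemma one_le_norm_denom_ρ (γ : SL(2, ℤ)) : 1 ≤ ‖denom γ ρ‖ := by
  have hpos := Complex.normSq_pos.mpr (denom_ne_zero γ ρ)
  rw [normSq_denom_ρ] at hpos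
  have hsq : 1 ≤ ‖denom γ ρ‖ ^ 2 := by
    rw [← Complex.normSq_eq_norm_sq, normSq_denom_ρ]
    exact_mod_cast Int.cast_pos.mp hpos
  exact (one_le_sq_iff₀ (norm_nonneg _)).mp hsq

lemma denom_discPoint (γ : SL(2, ℤ)) (hw : w ∈ ball (0 : ℂ) 1) :
    denom γ (discPoint w) = (denom γ ρ + conj (denom γ ρ) * w) / (1 + w) := by
  have hw1 := one_add_ne_zero_of_mem_ball hw
  rw [ModularGroup.denom_apply, ModularGroup.denom_apply, coe_discPoint hw, discTau]
  simp only [map_add, map_mul, map_intCast]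
  field_simp
  ring

lemma im_smul_discPoint_le (γ : SL(2, ℤ)) (hw : w ∈ ball (0 : ℂ) 1) :
    (γ • discPoint w).im ≤ √3 / 2 * ((1 + ‖w‖) / (1 - ‖w‖)) := by
  have hlt := mem_ball_zero_iff.mp hw
  have hpos : 0 < ‖1 + w‖ := norm_pos_iff.mpr (one_add_ne_zero_of_mem_ball hw)
  have hdenom : 1 - ‖w‖ ≤ ‖denom γ ρ + conj (denom γ ρ) * w‖ := by
    have htri := norm_sub_norm_le (denom γ ρ) (-(conj (denom γ ρ) * w))
    rw [norm_neg, norm_mul, Complex.norm_conj, sub_neg_eq_add] at htri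
    nlinarith [one_le_norm_denom_ρ γ]
  have hsq : (1 - ‖w‖) ^ 2 ≤ ‖denom γ ρ + conj (denom γ ρ) * w‖ ^ 2 := by
    gcongr
  rw [ModularGroup.im_smul_eq_div_normSq, Complex.normSq_eq_norm_sq, denom_discPoint γ hw,
    norm_div, im_discPoint hw, div_pow, mul_div_assoc, div_div_div_cancel_right₀ (by positivity)]
  refine mul_le_mul_of_nonneg_left ?_ (by positivity)
  rw [div_le_div_iff₀ (by nlinarith) (by linarith)]
  nlinarith [norm_nonneg w]

lemma im_sq_mul_norm_E₄_le_of_mem_fd (h : τ ∈ 𝒟) (him : τ.im ≤ 3 * √3 / 2) :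
    τ.im ^ 2 * ‖E₄ τ‖ ≤ 6.9 := by
  have hpos := τ.im_pos
  rcases le_total τ.im 1.8 with hle | hge
  · have hE := norm_E₄_le (qAbs_le_of_mem_fd h) (by norm_num)
    calc τ.im ^ 2 * ‖E₄ τ‖ ≤ 1.8 ^ 2 * (1 + 240 * (0.00434 / (1 - 16 * 0.00434))) := by gcongr
      _ ≤ _ := by norm_num
  · have hq : qAbs τ ≤ 0.0000125 := by
      refine (qAbs_le_of_le_im hge).trans ?_
      have := Real.pi_gt_d6
      exact exp_neg_le_of_inv_le_exp (by norm_num) (le_trans (by norm_num)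
        (le_exp_of_natCast_add_four_mul_le 11 0.0774 (by norm_num; linarith) (by norm_num)))
    have hE := norm_E₄_le hq (by norm_num)
    have hsq : τ.im ^ 2 ≤ 27 / 4 := by
      have : √3 ^ 2 = 3 := Real.sq_sqrt (by norm_num)
      nlinarith
    calc τ.im ^ 2 * ‖E₄ τ‖ ≤ 27 / 4 * (1 + 240 * (0.0000125 / (1 - 16 * 0.0000125))) := by gcongr
      _ ≤ _ := by norm_num

lemma norm_discE₄_le (hw : w ∈ ball (0 : ℂ) (1 / 2)) : ‖discE₄ w‖ ≤ 16.36 := by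
  have hw1 : w ∈ ball (0 : ℂ) 1 := ball_subset_ball (by norm_num) hw
  have hlt := mem_ball_zero_iff.mp hw
  obtain ⟨γ, hγ⟩ := ModularGroup.exists_smul_mem_fd (discPoint w)
  have hquot : (1 + ‖w‖) / (1 - ‖w‖) ≤ 3 := by
    rw [div_le_iff₀ (by linarith)]
    linarith
  have hE := im_sq_mul_norm_E₄_le_of_mem_fd hγ
    (by nlinarith [Real.sqrt_nonneg 3, im_smul_discPoint_le γ hw1])
  rw [im_sq_mul_norm_E₄_smul, im_sq_mul_norm_E₄_discPoint hw1] at hE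
  have hfactor : 9 / 16 ≤ (1 - ‖w‖ ^ 2) ^ 2 := by
    have : 3 / 4 ≤ 1 - ‖w‖ ^ 2 := by nlinarith [norm_nonneg w]
    nlinarith
  nlinarith [norm_nonneg (discE₄ w)]

lemma norm_eHat_le (hs : s ∈ ball (0 : ℂ) (1 / 8)) : ‖eHat s‖ ≤ 32.72 := by
  obtain ⟨w, hw, rfl⟩ := exists_mem_ball_pow_three_eq (ball_subset_ball (by norm_num) hs)
  have hnorm : ‖w‖ < 1 / 2 := by
    rw [mem_ball_zero_iff, norm_pow] at hs
    exact lt_of_pow_lt_pow_left₀ 3 (by norm_num) (hs.trans_eq (by norm_num))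
  rw [eHat_pow hw]
  refine (Complex.norm_dslope_le_div_of_mapsTo_ball (R₁ := 1 / 2) (R₂ := 16.36)
    (differentiableOn_discE₄.mono (ball_subset_ball (by norm_num))) (fun z hz ↦ ?_)
    (mem_ball_zero_iff.mpr hnorm)).trans_eq (by norm_num)
  rw [discE₄_zero, mem_closedBall_zero_iff]
  exact norm_discE₄_le hz

lemma norm_eHat_sub_eHat_zero_le (hs : s ∈ ball (0 : ℂ) (1 / 8)) :
    ‖eHat s - eHat 0‖ ≤ 523.6 * ‖s‖ := by
  have hmaps : MapsTo eHat (ball 0 (1 / 8)) (closedBall (eHat 0) 65.44) := fun z hz ↦ by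
    rw [mem_closedBall_iff_norm]
    linarith [norm_sub_le (eHat z) (eHat 0), norm_eHat_le hz,
      norm_eHat_le (mem_ball_self (by norm_num : (0 : ℝ) < 1 / 8))]
  have hschwarz := Complex.dist_le_div_mul_dist_of_mapsTo_ball
    (differentiableOn_eHat.mono (ball_subset_ball (by norm_num))) hmaps hs
  rw [dist_eq_norm, dist_zero_right] at hschwarz
  refine hschwarz.trans ?_
  gcongr
  norm_num

lemma ofReal_re_eHat_zero : ((eHat 0).re : ℂ) = eHat 0 := by
  simpa using ofReal_re_of_map_conj (x := 0) (eHat_conj (by simp))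

lemma ofReal_re_deltaHat_zero : ((deltaHat 0).re : ℂ) = deltaHat 0 := by
  simpa using ofReal_re_of_map_conj (x := 0) (deltaHat_conj (by simp))

lemma re_eHat_zero_le : (eHat 0).re ≤ -9.85 := by
  have hx : |(-1 / 10 : ℝ)| < 1 := by
    rw [abs_lt]
    norm_num
  obtain ⟨hpi_gt, -⟩ := pi_mul_sqrt_three_bounds
  have heHat := mul_eHat_pow (ofReal_mem_ball_zero_iff.mpr hx)
  rw [discE₄] at heHat
  have him : 2 * Real.pi * (discPoint (-1 / 10 : ℝ)).im = 11 / 9 * (Real.pi * √3) :=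
    (two_pi_mul_im_discPoint_ofReal hx).trans (by norm_num)
  set z := discPoint (-1 / 10 : ℝ)
  have hq : qAbs z ≤ 0.0013 := by
    rw [qAbs, him]
    exact exp_neg_le_of_inv_le_exp (by norm_num) (le_trans (by norm_num)
      (le_exp_of_natCast_add_four_mul_le 6 0.1625 (by norm_num; linarith) (by norm_num)))
  have hE := (Complex.abs_re_le_norm _).trans (norm_E₄_sub_one_le hq (by norm_num))
  rw [Complex.sub_re, Complex.one_re, abs_le] at hE
  have hvalue : eHat (((-1 / 10 : ℝ) : ℂ) ^ 3) = ((-100000 / 6561 : ℝ) : ℂ) * E₄ z := by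
    push_cast at heHat ⊢
    norm_num at heHat ⊢
    linear_combination (-10) * heHat
  have hnorm : ‖((-1 / 10 : ℝ) : ℂ) ^ 3‖ = 1 / 1000 := by
    rw [norm_pow, Complex.norm_real]
    norm_num
  have hsub := (Complex.abs_re_le_norm _).trans (norm_eHat_sub_eHat_zero_le
    (s := ((-1 / 10 : ℝ) : ℂ) ^ 3) (by rw [mem_ball_zero_iff, hnorm]; norm_num))
  rw [hnorm, Complex.sub_re, abs_le, hvalue, Complex.re_ofReal_mul] at hsub
  norm_num at hE hsub ⊢
  linarith

lemma re_deltaHat_zero_neg : (deltaHat 0).re < 0 := by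
  have hE₄ : E₄ ρ = 0 := by
    have h := discE₄_zero
    rw [discE₄, discPoint_zero] at h
    simpa using h
  have hE₆ : ((E₆ ρ).re : ℂ) = E₆ ρ := Complex.conj_eq_iff_re.mp
    (eisensteinSeries_conj (by norm_num : 3 ≤ 6) ⟨3, rfl⟩
      (by rw [conj_ρ]; ring : (ρ : ℂ) = -1 - conj (ρ : ℂ))).symm
  have hδ : deltaHat 0 = ((-((E₆ ρ).re ^ 2 / 1728) : ℝ) : ℂ) := by
    rw [deltaHat_zero, discriminant_eq_E₄_cube_sub_E₆_sq, hE₄]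
    push_cast
    rw [hE₆]
    ring
  have hne : deltaHat 0 ≠ 0 := deltaHat_ne_zero (mem_ball_self one_pos)
  rw [hδ, Complex.ofReal_ne_zero] at hne
  rw [hδ, Complex.ofReal_re]
  exact lt_of_le_of_ne (neg_nonpos.mpr (by positivity)) hne

lemma neg_re_deltaHat_zero_le : -(deltaHat 0).re ≤ 0.00482 :=
  calc -(deltaHat 0).re ≤ ‖deltaHat 0‖ := (neg_le_abs _).trans (Complex.abs_re_le_norm _)
    _ = ‖discriminant ρ‖ := by rw [deltaHat_zero]
    _ = Real.exp (Real.log ‖discriminant ρ‖) :=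
        (Real.exp_log (norm_pos_iff.mpr (discriminant_ne_zero ρ))).symm
    _ ≤ Real.exp (-5.3365) := Real.exp_le_exp.mpr log_norm_discriminant_ρ_bounds.2
    _ ≤ 0.00482 := exp_neg_le_of_inv_le_exp (by norm_num) (le_trans (by norm_num)
        (le_exp_of_natCast_add_four_mul_le 5 0.0841 (by norm_num) (by norm_num)))

lemma eHat_zero_ne_zero : eHat 0 ≠ 0 := fun h ↦ by
  have hre := re_eHat_zero_le
  norm_num [h] at hre

/-- The logarithm of `eHat / eHat 0`; only used near the origin, where it is holomorphic. -/
noncomputable def eLog (s : ℂ) : ℂ := Complex.log (eHat s / eHat 0)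

lemma norm_eHat_div_sub_one_le (hs : s ∈ ball (0 : ℂ) (1 / 110)) :
    ‖eHat s / eHat 0 - 1‖ ≤ 53.2 * ‖s‖ := by
  have hsub := norm_eHat_sub_eHat_zero_le (s := s) (ball_subset_ball (by norm_num) hs)
  have hnorm : 9.85 ≤ ‖eHat 0‖ := by
    linarith [(neg_le_abs _).trans (Complex.abs_re_le_norm (eHat 0)), re_eHat_zero_le]
  rw [div_sub_one eHat_zero_ne_zero, norm_div, div_le_iff₀ (by linarith)]
  nlinarith [norm_nonneg s]

lemma norm_eHat_div_sub_one_lt (hs : s ∈ ball (0 : ℂ) (1 / 110)) :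
    ‖eHat s / eHat 0 - 1‖ < 1 / 2 := by
  linarith [norm_eHat_div_sub_one_le hs, mem_ball_zero_iff.mp hs]

lemma eHat_div_mem_slitPlane (hs : s ∈ ball (0 : ℂ) (1 / 110)) :
    eHat s / eHat 0 ∈ Complex.slitPlane := by
  have hre := (Complex.abs_re_le_norm _).trans_lt (norm_eHat_div_sub_one_lt hs)
  rw [Complex.sub_re, Complex.one_re, abs_lt] at hre
  exact Or.inl (by linarith)

lemma exp_eLog (hs : s ∈ ball (0 : ℂ) (1 / 110)) : Complex.exp (eLog s) = eHat s / eHat 0 :=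
  Complex.exp_log (Complex.slitPlane_ne_zero (eHat_div_mem_slitPlane hs))

lemma eLog_conj (hs : s ∈ ball (0 : ℂ) (1 / 110)) : eLog (conj s) = conj (eLog s) := by
  have hreal : conj (eHat 0) = eHat 0 := by rw [← ofReal_re_eHat_zero, Complex.conj_ofReal]
  rw [eLog, eLog, eHat_conj (ball_subset_ball (by norm_num) hs),
    ← Complex.log_conj _ (Complex.slitPlane_arg_ne_pi (eHat_div_mem_slitPlane hs)), map_div₀, hreal]

lemma norm_eLog_le (hs : s ∈ ball (0 : ℂ) (1 / 110)) : ‖eLog s‖ ≤ 79.8 * ‖s‖ := by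
  have hlog := Complex.norm_log_one_add_half_le_self (norm_eHat_div_sub_one_lt hs).le
  rw [add_sub_cancel] at hlog
  rw [eLog]
  linarith [norm_eHat_div_sub_one_le hs]

lemma isRealBoundedOnBall_eLog : IsRealBoundedOnBall eLog (1 / 110) 0.75 where
  differentiableOn := ((differentiableOn_eHat.mono (ball_subset_ball (by norm_num))).div_const
    _).clog fun _ hs ↦ eHat_div_mem_slitPlane hs
  map_zero := by rw [eLog, div_self eHat_zero_ne_zero, Complex.log_one]
  map_conj _ := eLog_conj
  norm_le z hz := by linarith [norm_eLog_le hz, mem_ball_zero_iff.mp hz]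

/-- The derivative of `jHat` at the origin. -/
noncomputable def jScale : ℝ := (eHat 0).re ^ 3 / (deltaHat 0).re

lemma le_jScale : 198000 ≤ jScale := by
  have hδ := re_deltaHat_zero_neg
  have hcube : 955 ≤ (-(eHat 0).re) ^ 3 :=
    calc (955 : ℝ) ≤ 9.85 ^ 3 := by norm_num
      _ ≤ (-(eHat 0).re) ^ 3 := by
        gcongr
        linarith [re_eHat_zero_le]
  rw [jScale, ← neg_div_neg_eq, le_div_iff₀ (by linarith)]
  linarith [neg_re_deltaHat_zero_le, Odd.neg_pow (by decide : Odd 3) (eHat 0).re]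

lemma jHat_eq_mul_exp (hs : s ∈ ball (0 : ℂ) (1 / 110)) :
    jHat s = jScale * s * Complex.exp (3 * eLog s - deltaLog s) := by
  have hs1 : s ∈ ball (0 : ℂ) 1 := ball_subset_ball (by norm_num) hs
  have he := eHat_zero_ne_zero
  have hδ : deltaHat 0 ≠ 0 := deltaHat_ne_zero (mem_ball_self one_pos)
  have hscale : (jScale : ℂ) = eHat 0 ^ 3 / deltaHat 0 := by
    rw [jScale]
    push_cast
    rw [ofReal_re_eHat_zero, ofReal_re_deltaHat_zero]
  have hexp : Complex.exp (3 * eLog s) = (eHat s / eHat 0) ^ 3 := by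
    rw [← exp_eLog hs, ← Complex.exp_nat_mul, Nat.cast_ofNat]
  rw [Complex.exp_sub, hexp, hscale, jHat, ← deltaHat_zero_mul_exp_deltaLog hs1]
  field_simp

end EisensteinLogarithm

section EulerDerivative

/-- The Euler derivative `u f'(u)` at a real point `u`, for a function `f` that is real on the real
axis. -/
noncomputable def realEulerDeriv (f : ℂ → ℂ) (u : ℝ) : ℝ := (u * deriv f u).re

lemma realEulerDeriv_zero (f : ℂ → ℂ) : realEulerDeriv f 0 = 0 := by simp [realEulerDeriv]

lemma hasStrictDerivAt_re_comp_pow_three {f : ℂ → ℂ} {R r : ℝ}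
    (hf : DifferentiableOn ℂ f (ball 0 R)) (hr : |r ^ 3| < R) :
    HasStrictDerivAt (fun x : ℝ ↦ (f (x ^ 3 : ℝ)).re) (3 * realEulerDeriv f (r ^ 3) / r) r := by
  have hreal : HasStrictDerivAt (fun x : ℝ ↦ (f x).re) (deriv f (r ^ 3 : ℝ)).re (r ^ 3) :=
    (hf.analyticAt (isOpen_ball.mem_nhds
      (ofReal_mem_ball_zero_iff.mpr hr))).hasStrictDerivAt.real_of_complex
  refine (HasStrictDerivAt.comp (h := fun x : ℝ ↦ x ^ 3) r hreal
    (hasStrictDerivAt_pow 3 r)).congr_deriv ?_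
  rw [realEulerDeriv, Complex.re_ofReal_mul]
  field_simp
  norm_num
  ring

lemma tail_factor_le {x y : ℝ} (hx : 0 ≤ x) (hxy : x ≤ y) (hy : y < 1) :
    4 * x / (1 - x) ^ 3 ≤ 4 * y / (1 - y) ^ 3 := by
  have : 0 < 1 - y := sub_pos.mpr hy
  have : 0 ≤ y := hx.trans hxy
  gcongr

variable {r a b : ℝ} {s : ℂ}

lemma deltaLog_tail_factor_le (h0 : 0 ≤ r) (h : r ≤ 0.002197) :
    5.25 / (1 / 8) * (4 * (r / (1 / 8)) / (1 - r / (1 / 8)) ^ 3) ≤ 3.12 := by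
  have htail := tail_factor_le (x := r / (1 / 8)) (y := 0.017576) (by positivity) (by linarith)
    (by norm_num)
  norm_num at htail ⊢
  linarith

lemma eLog_tail_factor_le (h0 : 0 ≤ r) (h : r ≤ 0.002197) :
    0.75 / (1 / 110) * (4 * (r / (1 / 110)) / (1 - r / (1 / 110)) ^ 3) ≤ 183 := by
  have htail := tail_factor_le (x := r / (1 / 110)) (y := 0.24167) (by positivity) (by linarith)
    (by norm_num)
  norm_num at htail ⊢
  linarith

lemma abs_realTaylorCoeff_eLog_one_le : |realTaylorCoeff eLog 1| ≤ 82.5 :=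
  (isRealBoundedOnBall_eLog.abs_realTaylorCoeff_le (by norm_num) 1).trans (by norm_num)

lemma le_re_deltaLog_norm_sub (hs : ‖s‖ ≤ 0.002197) :
    10.8 * (‖s‖ - s.re) ≤ (deltaLog ‖s‖).re - (deltaLog s).re := by
  have hdefect : 0 ≤ ‖s‖ - s.re := sub_nonneg.mpr (Complex.re_le_norm s)
  have hlinear := isRealBoundedOnBall_deltaLog.abs_re_norm_sub_re_sub_linear_le
    (mem_ball_zero_iff.mpr (hs.trans_lt (by norm_num)))
  have htail := mul_le_mul_of_nonneg_left (deltaLog_tail_factor_le (norm_nonneg s) hs) hdefect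
  have hcoeff := mul_le_mul_of_nonneg_right realTaylorCoeff_deltaLog_one_bounds.1 hdefect
  linarith [(abs_le.mp hlinear).1]

lemma le_re_eLog_norm_sub (hs : ‖s‖ ≤ 0.002197) :
    -265.5 * (‖s‖ - s.re) ≤ (eLog ‖s‖).re - (eLog s).re := by
  have hdefect : 0 ≤ ‖s‖ - s.re := sub_nonneg.mpr (Complex.re_le_norm s)
  have hlinear := isRealBoundedOnBall_eLog.abs_re_norm_sub_re_sub_linear_le
    (mem_ball_zero_iff.mpr (hs.trans_lt (by norm_num)))
  have htail := mul_le_mul_of_nonneg_left (eLog_tail_factor_le (norm_nonneg s) hs) hdefect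
  have hcoeff := mul_le_mul_of_nonneg_right (abs_le.mp abs_realTaylorCoeff_eLog_one_le).1 hdefect
  linarith [(abs_le.mp hlinear).1]

lemma realEulerDeriv_deltaLog_sub_bounds (hb : 0 ≤ b) (hba : b ≤ a) (ha : a ≤ 0.002197) :
    10.8 * (a - b) ≤ realEulerDeriv deltaLog a - realEulerDeriv deltaLog b ∧
      realEulerDeriv deltaLog a - realEulerDeriv deltaLog b ≤ 24.7 * (a - b) := by
  have hsub : 0 ≤ a - b := sub_nonneg.mpr hba
  have ha0 : 0 ≤ a := hb.trans hba
  have hlinear := isRealBoundedOnBall_deltaLog.abs_re_mul_deriv_sub_sub_linear_le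
    (ha.trans_lt (by norm_num)) (abs_of_nonneg ha0).le ((abs_of_nonneg hb).trans_le hba)
  rw [abs_of_nonneg hsub, abs_le] at hlinear
  have htail := mul_le_mul_of_nonneg_left (deltaLog_tail_factor_le ha0 ha) hsub
  have hcoeff_ge := mul_le_mul_of_nonneg_right realTaylorCoeff_deltaLog_one_bounds.1 hsub
  have hcoeff_le := mul_le_mul_of_nonneg_right realTaylorCoeff_deltaLog_one_bounds.2 hsub
  rw [realEulerDeriv, realEulerDeriv]
  constructor <;> linarith [hlinear.1, hlinear.2]

lemma abs_realEulerDeriv_eLog_sub_le (hb : 0 ≤ b) (hba : b ≤ a) (ha : a ≤ 0.002197) :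
    |realEulerDeriv eLog a - realEulerDeriv eLog b| ≤ 265.5 * (a - b) := by
  have hsub : 0 ≤ a - b := sub_nonneg.mpr hba
  have ha0 : 0 ≤ a := hb.trans hba
  have hlinear := isRealBoundedOnBall_eLog.abs_re_mul_deriv_sub_sub_linear_le
    (ha.trans_lt (by norm_num)) (abs_of_nonneg ha0).le ((abs_of_nonneg hb).trans_le hba)
  rw [abs_of_nonneg hsub, abs_le] at hlinear
  have htail := mul_le_mul_of_nonneg_left (eLog_tail_factor_le ha0 ha) hsub
  have hcoeff := abs_le.mp abs_realTaylorCoeff_eLog_one_le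
  have hcoeff_ge := mul_le_mul_of_nonneg_right hcoeff.1 hsub
  have hcoeff_le := mul_le_mul_of_nonneg_right hcoeff.2 hsub
  rw [realEulerDeriv, realEulerDeriv, abs_le]
  constructor <;> linarith [hlinear.1, hlinear.2]

end EulerDerivative

section JProfile

variable {r : ℝ}

/-- The values of `j` along the positive real axis of the disc coordinate: `jProfile r` is
`jHat (r ^ 3)`, as a real number. -/
noncomputable def jProfile (r : ℝ) : ℝ :=
  jScale * r ^ 3 * Real.exp (3 * (eLog (r ^ 3 : ℝ)).re - (deltaLog (r ^ 3 : ℝ)).re)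

lemma jHat_ofReal_pow_three (hr : |r ^ 3| < 1 / 110) : jHat (r ^ 3 : ℝ) = jProfile r := by
  have hball := ofReal_mem_ball_zero_iff.mpr hr
  have hE := ofReal_re_of_map_conj (eLog_conj hball)
  have hδ := ofReal_re_of_map_conj (deltaLog_conj (ball_subset_ball (by norm_num) hball))
  rw [jHat_eq_mul_exp hball, ← hE, ← hδ, jProfile]
  push_cast
  rfl

lemma hasStrictDerivAt_jProfile (hr : |r ^ 3| < 1 / 110) :
    HasStrictDerivAt jProfile (jProfile r *
      (3 * (1 + 3 * realEulerDeriv eLog (r ^ 3) - realEulerDeriv deltaLog (r ^ 3)) / r)) r := by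
  have hE := hasStrictDerivAt_re_comp_pow_three isRealBoundedOnBall_eLog.differentiableOn hr
  have hδ := hasStrictDerivAt_re_comp_pow_three differentiableOn_deltaLog
    (hr.trans (by norm_num))
  refine (((hasStrictDerivAt_pow 3 r).const_mul jScale).mul
    ((hE.const_mul 3).sub hδ).exp).congr_deriv ?_
  rw [jProfile]
  rcases eq_or_ne r 0 with rfl | _
  · simp
  · field_simp
    norm_num
    ring

lemma abs_pow_three_lt (h0 : 0 ≤ r) (h : r ≤ 0.13) : |r ^ 3| < 1 / 110 := by
  rw [abs_of_nonneg (pow_nonneg h0 3)]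
  exact (pow_le_pow_left₀ h0 h 3).trans_lt (by norm_num)

lemma one_le_jProfile : 1 ≤ jProfile 0.0175 := by
  have hball : ((0.0175 ^ 3 : ℝ) : ℂ) ∈ ball (0 : ℂ) (1 / 110) :=
    ofReal_mem_ball_zero_iff.mpr (abs_pow_three_lt (by norm_num) (by norm_num))
  have hE := (Complex.abs_re_le_norm _).trans (norm_eLog_le hball)
  have hδ := (Complex.abs_re_le_norm _).trans (norm_deltaLog_le_mul_norm hball)
  rw [Complex.norm_real, Real.norm_of_nonneg (by norm_num), abs_le] at hE hδ
  have hexp : 0.998 ≤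
      Real.exp (3 * (eLog (0.0175 ^ 3 : ℝ)).re - (deltaLog (0.0175 ^ 3 : ℝ)).re) := by
    refine le_trans ?_ (Real.add_one_le_exp _)
    linarith [hE.1, hδ.2]
  have hscale : 0 ≤ jScale := le_trans (by norm_num) le_jScale
  calc (1 : ℝ) ≤ 198000 * 0.0175 ^ 3 * 0.998 := by norm_num
    _ ≤ jProfile 0.0175 := by
      rw [jProfile]
      gcongr
      exact le_jScale

lemma exists_jProfile_eq_one : ∃ r, 0 < r ∧ r ≤ 0.0175 ∧ jProfile r = 1 := by
  have hcont : ContinuousOn jProfile (Icc 0 0.0175) := fun r hr ↦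
    (hasStrictDerivAt_jProfile (abs_pow_three_lt hr.1 (hr.2.trans
      (by norm_num)))).hasDerivAt.continuousAt.continuousWithinAt
  have hzero : jProfile 0 = 0 := by simp [jProfile]
  obtain ⟨r, hr, hvalue⟩ := intermediate_value_Icc (by norm_num) hcont
    ⟨hzero.trans_le zero_le_one, one_le_jProfile⟩
  refine ⟨r, hr.1.lt_of_ne ?_, hr.2, hvalue⟩
  rintro rfl
  exact zero_ne_one (hzero.symm.trans hvalue)

/-- The disc coordinate of the point near `ρ` where `j` takes the value `1`. -/
noncomputable def jRadius : ℝ := exists_jProfile_eq_one.choose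

lemma jRadius_pos : 0 < jRadius := exists_jProfile_eq_one.choose_spec.1

lemma jRadius_le : jRadius ≤ 0.0175 := exists_jProfile_eq_one.choose_spec.2.1

lemma jProfile_jRadius : jProfile jRadius = 1 := exists_jProfile_eq_one.choose_spec.2.2

lemma abs_jRadius_lt_one : |jRadius| < 1 := by
  rw [abs_of_pos jRadius_pos]
  exact jRadius_le.trans_lt (by norm_num)

lemma abs_jRadius_pow_three_lt : |jRadius ^ 3| < 1 / 110 :=
  abs_pow_three_lt jRadius_pos.le (jRadius_le.trans (by norm_num))

lemma jRadius_pow_three_le : jRadius ^ 3 ≤ 0.0000054 :=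
  (pow_le_pow_left₀ jRadius_pos.le jRadius_le 3).trans (by norm_num)

lemma jHat_jRadius_pow_three : jHat (jRadius ^ 3 : ℝ) = 1 := by
  rw [jHat_ofReal_pow_three abs_jRadius_pow_three_lt, jProfile_jRadius, Complex.ofReal_one]

end JProfile

section SlopeAtOne

/-- The value of `∂ₓ g_hyp(1)`: with `r = jRadius`, the logarithmic derivative in `r` of `gInfty`
divided by that of `j`. -/
noncomputable def slopeAtOne : ℝ :=
  (4 * (jRadius ^ 2 / (1 - jRadius ^ 2)) - realEulerDeriv deltaLog (jRadius ^ 3)) /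
    (1 + 3 * realEulerDeriv eLog (jRadius ^ 3) - realEulerDeriv deltaLog (jRadius ^ 3))

lemma realEulerDeriv_deltaLog_jRadius_bounds :
    0 ≤ realEulerDeriv deltaLog (jRadius ^ 3) ∧
      realEulerDeriv deltaLog (jRadius ^ 3) ≤ 24.7 * jRadius ^ 3 := by
  have hpos := pow_pos jRadius_pos 3
  have hbounds := realEulerDeriv_deltaLog_sub_bounds le_rfl hpos.le
    (jRadius_pow_three_le.trans (by norm_num))
  rw [realEulerDeriv_zero] at hbounds
  constructor <;> linarith [hbounds.1, hbounds.2]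

lemma le_slopeAtOne_denom :
    0.99 ≤ 1 + 3 * realEulerDeriv eLog (jRadius ^ 3) - realEulerDeriv deltaLog (jRadius ^ 3) := by
  have hE := abs_realEulerDeriv_eLog_sub_le le_rfl (pow_pos jRadius_pos 3).le
    (jRadius_pow_three_le.trans (by norm_num))
  rw [realEulerDeriv_zero, sub_zero, abs_le] at hE
  linarith [hE.1, realEulerDeriv_deltaLog_jRadius_bounds.2, jRadius_pow_three_le]

lemma slopeAtOne_denom_pos :
    0 < 1 + 3 * realEulerDeriv eLog (jRadius ^ 3) - realEulerDeriv deltaLog (jRadius ^ 3) :=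
  lt_of_lt_of_le (by norm_num) le_slopeAtOne_denom

lemma one_sub_jRadius_sq_pos : 0 < 1 - jRadius ^ 2 := by
  nlinarith [jRadius_pos, jRadius_le]

lemma slopeAtOne_pos : 0 < slopeAtOne := by
  refine div_pos ?_ slopeAtOne_denom_pos
  have hsq : 0 < jRadius ^ 2 := pow_pos jRadius_pos 2
  have hquot : jRadius ^ 2 ≤ jRadius ^ 2 / (1 - jRadius ^ 2) :=
    le_div_self hsq.le one_sub_jRadius_sq_pos (sub_le_self 1 hsq.le)
  have hcube : jRadius ^ 3 ≤ 0.0175 * jRadius ^ 2 := by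
    rw [pow_succ']
    exact mul_le_mul_of_nonneg_right jRadius_le hsq.le
  linarith [realEulerDeriv_deltaLog_jRadius_bounds.2]

lemma slopeAtOne_le : slopeAtOne ≤ 0.00125 := by
  have hquot : jRadius ^ 2 / (1 - jRadius ^ 2) ≤ 0.00030635 := by
    rw [div_le_iff₀ one_sub_jRadius_sq_pos]
    nlinarith [jRadius_pos, jRadius_le]
  rw [slopeAtOne, div_le_iff₀ slopeAtOne_denom_pos]
  linarith [realEulerDeriv_deltaLog_jRadius_bounds.1, le_slopeAtOne_denom]

end SlopeAtOne

section GHyp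

lemma hasDerivAt_of_comp_eventuallyEq {𝕜 F : Type*} [NontriviallyNormedField 𝕜] [CompleteSpace 𝕜]
    [NormedAddCommGroup F] [NormedSpace 𝕜 F] {φ : 𝕜 → 𝕜} {g u : 𝕜 → F} {a φ' : 𝕜} {u' : F}
    (hφ : HasStrictDerivAt φ φ' a) (hφ' : φ' ≠ 0) (hu : HasDerivAt u u' a)
    (hcomp : g ∘ φ =ᶠ[𝓝 a] u) : HasDerivAt g (φ'⁻¹ • u') (φ a) := by
  set ψ := hφ.localInverse φ φ' a hφ'
  have hψa : ψ (φ a) = a := (hφ.eventually_left_inverse hφ').self_of_nhds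
  have hψ : HasDerivAt ψ φ'⁻¹ (φ a) := (hφ.to_localInverse hφ').hasDerivAt
  have hg : g =ᶠ[𝓝 (φ a)] u ∘ ψ := by
    have hcompψ := (hψa ▸ hψ.continuousAt.tendsto).eventually hcomp
    filter_upwards [hφ.eventually_right_inverse hφ', hcompψ] with t hright heq
    rw [Function.comp_apply, ← heq, Function.comp_apply, hright]
  exact (HasDerivAt.scomp (φ a) (hψa.symm ▸ hu) hψ).congr_of_eventuallyEq hg

variable {w : ℂ} {g : ℂ → ℝ}

lemma logPetersson_ρ : logPetersson ρ = 3 * Real.log (3 / 4) + Real.log ‖discriminant ρ‖ := by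
  simpa [discPoint_zero, deltaHat_zero] using logPetersson_discPoint (mem_ball_self one_pos)

lemma gInfty_discPoint (hw : w ∈ ball (0 : ℂ) 1) :
    gInfty (discPoint w) = gInfty ρ - 6 * Real.log (1 - ‖w‖ ^ 2) - (deltaLog (w ^ 3)).re := by
  rw [gInfty_eq_sub_logPetersson, gInfty_eq_sub_logPetersson, logPetersson_discPoint hw,
    log_norm_deltaHat (pow_three_mem_ball_iff.mpr hw), logPetersson_ρ]
  ring

lemma gHyp_jHat_pow_three (hg : gInfty = g ∘ jInv) (hw : w ∈ ball (0 : ℂ) 1) :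
    g (jHat (w ^ 3)) = gInfty ρ - 6 * Real.log (1 - ‖w‖ ^ 2) - (deltaLog (w ^ 3)).re := by
  rw [← jInv_discPoint hw, ← gInfty_discPoint hw, hg, Function.comp_apply]

lemma gHyp_jHat_ofReal_pow_three (hg : gInfty = g ∘ jInv) {r : ℝ} (hr : |r| < 1) :
    g (jHat (r ^ 3 : ℝ)) = gInfty ρ - 6 * Real.log (1 - r ^ 2) - (deltaLog (r ^ 3 : ℝ)).re := by
  simpa using gHyp_jHat_pow_three hg (ofReal_mem_ball_zero_iff.mpr hr)

lemma gHyp_comp_jProfile_eventuallyEq (hg : gInfty = g ∘ jInv) :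
    (fun t : ℝ ↦ g t) ∘ jProfile =ᶠ[𝓝 jRadius] fun r ↦
      gInfty ρ - 6 * Real.log (1 - r ^ 2) - (deltaLog (r ^ 3 : ℝ)).re := by
  have hsmall : ∀ᶠ r : ℝ in 𝓝 jRadius, |r| < 1 :=
    continuous_abs.continuousAt.eventually_lt continuousAt_const abs_jRadius_lt_one
  have hcube : ∀ᶠ r : ℝ in 𝓝 jRadius, |r ^ 3| < 1 / 110 :=
    ContinuousAt.eventually_lt (by fun_prop) continuousAt_const abs_jRadius_pow_three_lt
  filter_upwards [hsmall, hcube] with r hr hr3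
  rw [Function.comp_apply, ← jHat_ofReal_pow_three hr3, gHyp_jHat_ofReal_pow_three hg hr]

lemma hasDerivAt_gHyp_jRadius_profile :
    HasDerivAt (fun r : ℝ ↦ gInfty ρ - 6 * Real.log (1 - r ^ 2) - (deltaLog (r ^ 3 : ℝ)).re)
      (3 * (4 * (jRadius ^ 2 / (1 - jRadius ^ 2)) - realEulerDeriv deltaLog (jRadius ^ 3)) /
        jRadius) jRadius := by
  have hδ := (hasStrictDerivAt_re_comp_pow_three differentiableOn_deltaLog
    (abs_jRadius_pow_three_lt.trans (by norm_num))).hasDerivAt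
  have hR := jRadius_pos.ne'
  have hsq := one_sub_jRadius_sq_pos.ne'
  refine (((((hasDerivAt_pow 2 jRadius).const_sub 1).log hsq).const_mul 6).const_sub
    (gInfty ρ)).sub hδ |>.congr_deriv ?_
  field_simp
  ring

lemma hasDerivAt_gHyp_ofReal (hg : gInfty = g ∘ jInv) :
    HasDerivAt (fun t : ℝ ↦ g t) slopeAtOne 1 := by
  have hR := jRadius_pos.ne'
  have hdenom := slopeAtOne_denom_pos.ne'
  have hj := hasStrictDerivAt_jProfile abs_jRadius_pow_three_lt
  rw [jProfile_jRadius, one_mul] at hj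
  have hderiv := hasDerivAt_of_comp_eventuallyEq hj (by positivity) hasDerivAt_gHyp_jRadius_profile
    (gHyp_comp_jProfile_eventuallyEq hg)
  rw [jProfile_jRadius] at hderiv
  refine hderiv.congr_deriv ?_
  rw [slopeAtOne, smul_eq_mul]
  field_simp

lemma hasLineDerivAt_of_eq_comp_jInv (hg : gInfty = g ∘ jInv) :
    HasLineDerivAt ℝ g slopeAtOne (1 : ℂ) (1 : ℂ) := by
  have hderiv : HasDerivAt (fun t : ℝ ↦ g ((1 + t : ℝ) : ℂ)) slopeAtOne 0 :=
    HasDerivAt.comp_const_add (f := fun t : ℝ ↦ g t) 1 0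
      (by simpa using hasDerivAt_gHyp_ofReal hg)
  simpa [HasLineDerivAt] using hderiv

end GHyp

section RadialProfile

variable {r a b : ℝ}

/-- The restriction of `g₁ ∘ j` to the positive real axis of the disc coordinate, up to an additive
constant. -/
noncomputable def radialProfile (r : ℝ) : ℝ :=
  -(6 * Real.log (1 - r ^ 2)) - 3 * slopeAtOne * Real.log r -
    ((1 - slopeAtOne) * (deltaLog (r ^ 3 : ℝ)).re + 3 * slopeAtOne * (eLog (r ^ 3 : ℝ)).re)

/-- A third of the Euler derivative `r d/dr` of `radialProfile`. -/
noncomputable def radialSlope (r : ℝ) : ℝ :=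
  4 * (r ^ 2 / (1 - r ^ 2)) - slopeAtOne - ((1 - slopeAtOne) * realEulerDeriv deltaLog (r ^ 3) +
    3 * slopeAtOne * realEulerDeriv eLog (r ^ 3))

lemma hasDerivAt_radialProfile (h0 : 0 < r) (h : r ≤ 0.13) :
    HasDerivAt radialProfile (3 * radialSlope r / r) r := by
  have hcube := abs_pow_three_lt h0.le h
  have hδ := (hasStrictDerivAt_re_comp_pow_three differentiableOn_deltaLog
    (hcube.trans (by norm_num))).hasDerivAt
  have hE := (hasStrictDerivAt_re_comp_pow_three isRealBoundedOnBall_eLog.differentiableOn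
    hcube).hasDerivAt
  have hsq : 1 - r ^ 2 ≠ 0 := by nlinarith
  refine ((((((hasDerivAt_pow 2 r).const_sub 1).log hsq).const_mul 6).neg.sub
    ((Real.hasDerivAt_log h0.ne').const_mul (3 * slopeAtOne))).sub
    ((hδ.const_mul (1 - slopeAtOne)).add (hE.const_mul (3 * slopeAtOne)))).congr_deriv ?_
  rw [radialSlope]
  field_simp
  ring

lemma sq_sub_sq_le_div_one_sub_sq_sub (hb : 0 ≤ b) (hba : b ≤ a) (ha : a < 1) :
    a ^ 2 - b ^ 2 ≤ a ^ 2 / (1 - a ^ 2) - b ^ 2 / (1 - b ^ 2) := by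
  have hsq : b ^ 2 ≤ a ^ 2 := pow_le_pow_left₀ hb hba 2
  have ha1 : 0 < 1 - a ^ 2 := by nlinarith
  have hb1 : 0 < 1 - b ^ 2 := by linarith
  have hprod : (1 - a ^ 2) * (1 - b ^ 2) ≤ 1 :=
    mul_le_one₀ (sub_le_self 1 (sq_nonneg a)) hb1.le (sub_le_self 1 (sq_nonneg b))
  rw [div_sub_div _ _ ha1.ne' hb1.ne', le_div_iff₀ (mul_pos ha1 hb1)]
  nlinarith

lemma pow_three_sub_pow_three_le (hb : 0 ≤ b) (hba : b ≤ a) :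
    a ^ 3 - b ^ 3 ≤ (a + b) * (a ^ 2 - b ^ 2) := by
  nlinarith [mul_nonneg (mul_nonneg (hb.trans hba) hb) (sub_nonneg.mpr hba)]

lemma radialSlope_lt (hb : 0 ≤ b) (hba : b < a) (ha : a ≤ 0.13) (hab : a + b ≤ 0.1475) :
    radialSlope b < radialSlope a := by
  have hsq : 0 < a ^ 2 - b ^ 2 := sub_pos.mpr (pow_lt_pow_left₀ hba hb two_ne_zero)
  have hcube : b ^ 3 ≤ a ^ 3 := pow_le_pow_left₀ hb hba.le 3
  have ha3 : a ^ 3 ≤ 0.002197 := (pow_le_pow_left₀ (hb.trans hba.le) ha 3).trans (by norm_num)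
  have hpos := slopeAtOne_pos
  have hle := slopeAtOne_le
  obtain ⟨hδ_ge, hδ_le⟩ := realEulerDeriv_deltaLog_sub_bounds (pow_nonneg hb 3) hcube ha3
  have hE := (abs_le.mp (abs_realEulerDeriv_eLog_sub_le (pow_nonneg hb 3) hcube ha3)).2
  have hδ : (1 - slopeAtOne) *
      (realEulerDeriv deltaLog (a ^ 3) - realEulerDeriv deltaLog (b ^ 3)) ≤
        24.7 * (a ^ 3 - b ^ 3) := by nlinarith
  have hE' : 3 * slopeAtOne * (realEulerDeriv eLog (a ^ 3) - realEulerDeriv eLog (b ^ 3)) ≤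
      1 * (a ^ 3 - b ^ 3) := by nlinarith
  have hmain := sq_sub_sq_le_div_one_sub_sq_sub hb hba.le (by linarith)
  have hcube_le : a ^ 3 - b ^ 3 ≤ 0.1475 * (a ^ 2 - b ^ 2) :=
    (pow_three_sub_pow_three_le hb hba.le).trans (mul_le_mul_of_nonneg_right hab hsq.le)
  rw [radialSlope, radialSlope]
  linarith

lemma radialSlope_jRadius : radialSlope jRadius = 0 := by
  have hslope := div_mul_cancel₀ (4 * (jRadius ^ 2 / (1 - jRadius ^ 2)) -
    realEulerDeriv deltaLog (jRadius ^ 3)) slopeAtOne_denom_pos.ne'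
  rw [← slopeAtOne] at hslope
  rw [radialSlope]
  linear_combination -hslope

lemma strictAntiOn_radialProfile (h0 : 0 < r) : StrictAntiOn radialProfile (Icc r jRadius) := by
  have hderiv {x : ℝ} (hx : x ∈ Icc r jRadius) :
      HasDerivAt radialProfile (3 * radialSlope x / x) x :=
    hasDerivAt_radialProfile (h0.trans_le hx.1) (by linarith [hx.2, jRadius_le])
  refine strictAntiOn_of_deriv_neg (convex_Icc _ _)
    (fun x hx ↦ (hderiv hx).continuousAt.continuousWithinAt) fun x hx ↦ ?_
  rw [(hderiv (interior_subset hx)).deriv]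
  rw [interior_Icc] at hx
  have hx0 := h0.trans hx.1
  have hslope := radialSlope_lt hx0.le hx.2 (by linarith [jRadius_le])
    (by linarith [hx.2, jRadius_le])
  rw [radialSlope_jRadius] at hslope
  exact div_neg_of_neg_of_pos (by linarith) hx0

lemma strictMonoOn_radialProfile : StrictMonoOn radialProfile (Icc jRadius 0.13) := by
  have hderiv {x : ℝ} (hx : x ∈ Icc jRadius 0.13) :
      HasDerivAt radialProfile (3 * radialSlope x / x) x :=
    hasDerivAt_radialProfile (jRadius_pos.trans_le hx.1) hx.2
  refine strictMonoOn_of_deriv_pos (convex_Icc _ _)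
    (fun x hx ↦ (hderiv hx).continuousAt.continuousWithinAt) fun x hx ↦ ?_
  rw [(hderiv (interior_subset hx)).deriv]
  rw [interior_Icc] at hx
  have hslope := radialSlope_lt jRadius_pos.le hx.1 hx.2.le (by linarith [hx.2, jRadius_le])
  rw [radialSlope_jRadius] at hslope
  exact div_pos (by linarith) (jRadius_pos.trans hx.1)

lemma radialProfile_jRadius_lt (h0 : 0 < r) (h : r ≤ 0.13) (hne : r ≠ jRadius) :
    radialProfile jRadius < radialProfile r := by
  rcases hne.lt_or_gt with hlt | hgt
  · exact strictAntiOn_radialProfile h0 (left_mem_Icc.mpr hlt.le) (right_mem_Icc.mpr hlt.le) hlt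
  · exact strictMonoOn_radialProfile (left_mem_Icc.mpr (hgt.le.trans h)) ⟨hgt.le, h⟩ hgt

end RadialProfile

section NearRho

variable {g : ℂ → ℝ} {s w : ℂ}

lemma log_norm_jHat (hs : s ∈ ball (0 : ℂ) (1 / 110)) (h0 : s ≠ 0) :
    Real.log ‖jHat s‖ = Real.log jScale + Real.log ‖s‖ + 3 * (eLog s).re - (deltaLog s).re := by
  have hscale : 0 < jScale := lt_of_lt_of_le (by norm_num) le_jScale
  have hnorm : 0 < ‖s‖ := norm_pos_iff.mpr h0
  rw [jHat_eq_mul_exp hs, norm_mul, norm_mul, Complex.norm_real, Real.norm_of_nonneg hscale.le,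
    Complex.norm_exp, Real.log_mul (by positivity) (by positivity),
    Real.log_mul hscale.ne' hnorm.ne', Real.log_exp, Complex.sub_re,
    show (3 * eLog s).re = 3 * (eLog s).re by simp]
  ring

lemma gOne_jHat_pow_three (hg : gInfty = g ∘ jInv) (h0 : w ≠ 0) (h : ‖w‖ ≤ 0.13) :
    gOne g (jHat (w ^ 3)) = gInfty ρ - slopeAtOne * Real.log jScale + radialProfile ‖w‖ +
      ((1 - slopeAtOne) * ((deltaLog ‖w ^ 3‖).re - (deltaLog (w ^ 3)).re) +
        3 * slopeAtOne * ((eLog ‖w ^ 3‖).re - (eLog (w ^ 3)).re)) := by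
  have hw : w ∈ ball (0 : ℂ) 1 := mem_ball_zero_iff.mpr (h.trans_lt (by norm_num))
  have hcube : w ^ 3 ∈ ball (0 : ℂ) (1 / 110) := by
    rw [mem_ball_zero_iff, norm_pow]
    exact (le_abs_self _).trans_lt (abs_pow_three_lt (norm_nonneg w) h)
  rw [gOne, (hasLineDerivAt_of_eq_comp_jInv hg).lineDeriv, gHyp_jHat_pow_three hg hw,
    log_norm_jHat hcube (pow_ne_zero 3 h0), norm_pow, Real.log_pow, radialProfile]
  push_cast
  ring

lemma le_angular_defect (hs : ‖s‖ ≤ 0.002197) :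
    9 * (‖s‖ - s.re) ≤ (1 - slopeAtOne) * ((deltaLog ‖s‖).re - (deltaLog s).re) +
        3 * slopeAtOne * ((eLog ‖s‖).re - (eLog s).re) := by
  have hpos := slopeAtOne_pos
  have hle := slopeAtOne_le
  have hdefect : 0 ≤ ‖s‖ - s.re := sub_nonneg.mpr (Complex.re_le_norm s)
  calc 9 * (‖s‖ - s.re)
      ≤ (1 - slopeAtOne) * (10.8 * (‖s‖ - s.re)) +
        3 * slopeAtOne * (-265.5 * (‖s‖ - s.re)) := by nlinarith
    _ ≤ _ := add_le_add
      (mul_le_mul_of_nonneg_left (le_re_deltaLog_norm_sub hs) (by linarith))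
      (mul_le_mul_of_nonneg_left (le_re_eLog_norm_sub hs) (by linarith))

lemma norm_ofReal_jRadius : ‖(jRadius : ℂ)‖ = jRadius :=
  (Complex.norm_real _).trans (Real.norm_of_nonneg jRadius_pos.le)

lemma gOne_one (hg : gInfty = g ∘ jInv) :
    gOne g 1 = gInfty ρ - slopeAtOne * Real.log jScale + radialProfile jRadius := by
  have hvalue := gOne_jHat_pow_three hg (w := jRadius)
    (Complex.ofReal_ne_zero.mpr jRadius_pos.ne')
    (norm_ofReal_jRadius.trans_le (jRadius_le.trans (by norm_num)))
  rw [norm_pow, norm_ofReal_jRadius, ← Complex.ofReal_pow, jHat_jRadius_pow_three] at hvalue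
  rw [hvalue]
  ring

lemma gOne_one_lt_of_norm_le (hg : gInfty = g ∘ jInv) (h0 : w ≠ 0) (h : ‖w‖ ≤ 0.13)
    (hne : jHat (w ^ 3) ≠ 1) : gOne g 1 < gOne g (jHat (w ^ 3)) := by
  rw [gOne_one hg, gOne_jHat_pow_three hg h0 h]
  have hs : ‖w ^ 3‖ ≤ 0.002197 := by
    rw [norm_pow]
    exact (pow_le_pow_left₀ (norm_nonneg w) h 3).trans (by norm_num)
  have hangular := le_angular_defect hs
  have hre := Complex.re_le_norm (w ^ 3)
  rcases eq_or_ne ‖w‖ jRadius with hr | hr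
  · have hre_ne : (w ^ 3).re ≠ ‖w ^ 3‖ := fun heq ↦ hne <| by
      rw [Complex.eq_coe_norm_of_nonneg (Complex.re_eq_norm.mp heq), norm_pow, hr,
        jHat_jRadius_pow_three]
    rw [hr]
    linarith [hre.lt_of_ne hre_ne]
  · linarith [radialProfile_jRadius_lt (norm_pos_iff.mpr h0) h hr]

end NearRho

section FarFromRho

variable {g : ℂ → ℝ} {τ : ℍ}

lemma E₄_ne_zero_of_jInv_ne_zero (h : jInv τ ≠ 0) : E₄ τ ≠ 0 := by
  contrapose! h
  simp [jInv, h]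

lemma log_norm_jInv (h : jInv τ ≠ 0) :
    Real.log ‖jInv τ‖ = 3 * Real.log ‖E₄ τ‖ - Real.log ‖discriminant τ‖ := by
  rw [jInv, norm_div, norm_pow, Real.log_div
    (pow_ne_zero 3 (norm_ne_zero_iff.mpr (E₄_ne_zero_of_jInv_ne_zero h)))
    (norm_ne_zero_iff.mpr (discriminant_ne_zero τ)), Real.log_pow, Nat.cast_ofNat]

lemma gOne_one_le (hg : gInfty = g ∘ jInv) :
    gOne g 1 ≤ -(6 * Real.log (4 * Real.pi)) + 6.2037 := by
  have hpos := jRadius_pos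
  have hle := jRadius_le
  have hsq := one_sub_jRadius_sq_pos
  have hvalue := gHyp_jHat_ofReal_pow_three hg abs_jRadius_lt_one
  rw [jHat_jRadius_pow_three] at hvalue
  rw [gOne, norm_one, Real.log_one, mul_zero, sub_zero, hvalue, gInfty_eq_sub_logPetersson,
    logPetersson_ρ]
  have hδ := (Complex.abs_re_le_norm _).trans (norm_deltaLog_le_mul_norm
    (ofReal_mem_ball_zero_iff.mpr abs_jRadius_pow_three_lt))
  rw [Complex.norm_real, Real.norm_of_nonneg (pow_nonneg hpos.le 3), abs_le] at hδ
  have hinv : (1 - jRadius ^ 2)⁻¹ ≤ 1.0003065 := by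
    rw [inv_le_comm₀ hsq (by norm_num)]
    norm_num
    nlinarith
  linarith [hδ.1, Real.one_sub_inv_le_log_of_pos hsq, jRadius_pow_three_le,
    log_three_div_four_bounds.1, log_norm_discriminant_ρ_bounds.1]

lemma qAbs_le_of_point_957_le_im (hτ : 0.957 ≤ τ.im) : qAbs τ ≤ 0.00246 := by
  have hpi := Real.pi_gt_d6
  exact (qAbs_le_of_le_im hτ).trans (exp_neg_le_of_inv_le_exp (by norm_num) (le_trans
    (by norm_num) (le_exp_of_natCast_add_four_mul_le 6 0.003 (by norm_num; linarith)
      (by norm_num))))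

lemma log_norm_E₄_le_of_point_957_le_im (hτ : 0.957 ≤ τ.im) (hE : E₄ τ ≠ 0) :
    Real.log ‖E₄ τ‖ ≤ 0.62 := by
  have hnorm := norm_E₄_le (qAbs_le_of_point_957_le_im hτ) (by norm_num)
  have hlog := Real.log_le_sub_one_of_pos (norm_pos_iff.mpr hE)
  norm_num at hnorm ⊢
  linarith

lemma log_norm_discriminant_le_of_point_957_le_im (hτ : 0.957 ≤ τ.im) :
    Real.log ‖discriminant τ‖ ≤ -(2 * Real.pi * τ.im) + 0.0592 := by
  have hfrac := div_one_sub_le_div_one_sub (qAbs_le_of_point_957_le_im hτ) (by norm_num)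
  have hlog := log_norm_discriminant_le τ
  norm_num at hfrac
  linarith

lemma log_point_957_le : Real.log 0.957 ≤ -0.0439 :=
  log_le_neg_of_exp_le_inv (by norm_num) ((exp_le_of_le_natCast_add_four_mul 0 0.010975
    (by norm_num) (by norm_num) (by norm_num)).trans (by norm_num))

lemma gOne_jInv (hg : gInfty = g ∘ jInv) (hj : jInv τ ≠ 0) :
    gOne g (jInv τ) = -(6 * Real.log (4 * Real.pi)) - 6 * Real.log τ.im -
      (1 - slopeAtOne) * Real.log ‖discriminant τ‖ - 3 * slopeAtOne * Real.log ‖E₄ τ‖ := by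
  have hvalue : g (jInv τ) = gInfty τ := (congrFun hg τ).symm
  rw [gOne, (hasLineDerivAt_of_eq_comp_jInv hg).lineDeriv, hvalue, gInfty_eq_sub_logPetersson,
    log_norm_jInv hj, logPetersson_eq]
  ring

lemma gOne_one_lt_of_le_im (hg : gInfty = g ∘ jInv) (hτ : 0.957 ≤ τ.im) (hj : jInv τ ≠ 0) :
    gOne g 1 < gOne g (jInv τ) := by
  have hpos := slopeAtOne_pos
  have hle := slopeAtOne_le
  have hE : 3 * slopeAtOne * Real.log ‖E₄ τ‖ ≤ 3 * slopeAtOne * 0.62 :=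
    mul_le_mul_of_nonneg_left
      (log_norm_E₄_le_of_point_957_le_im hτ (E₄_ne_zero_of_jInv_ne_zero hj)) (by linarith)
  have hΔ : (1 - slopeAtOne) * Real.log ‖discriminant τ‖ ≤
      (1 - slopeAtOne) * (-(2 * Real.pi * τ.im) + 0.0592) :=
    mul_le_mul_of_nonneg_left (log_norm_discriminant_le_of_point_957_le_im hτ) (by linarith)
  have hpi : 6.2753 ≤ (1 - slopeAtOne) * (2 * Real.pi) := by nlinarith [Real.pi_gt_d6]
  have him := log_le_log_add_div_sub_one τ.im_pos (by norm_num : (0 : ℝ) < 0.957)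
  have hdiv : τ.im / 0.957 ≤ 1.0449321 * τ.im := by
    rw [div_le_iff₀ (by norm_num)]
    linarith
  rw [gOne_jInv hg hj]
  linarith [gOne_one_le hg, log_point_957_le, mul_le_mul_of_nonneg_right hpi τ.im_pos.le]

end FarFromRho

section Covering

variable {τ : ℍ}

lemma sq_norm_coe_sub_ρ (τ : ℍ) :
    ‖(ρ : ℂ) - τ‖ ^ 2 = (τ.re + 1 / 2) ^ 2 + (τ.im - √3 / 2) ^ 2 := by
  rw [← Complex.normSq_eq_norm_sq, Complex.normSq_apply]
  simp only [Complex.sub_re, Complex.sub_im, coe_re, coe_im, ρ_re, ρ_im]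
  ring

lemma sq_norm_coe_sub_conj_ρ (τ : ℍ) :
    ‖(τ : ℂ) - conj (ρ : ℂ)‖ ^ 2 = (τ.re + 1 / 2) ^ 2 + (τ.im + √3 / 2) ^ 2 := by
  rw [← Complex.normSq_eq_norm_sq, Complex.normSq_apply]
  simp only [Complex.sub_re, Complex.sub_im, Complex.conj_re, Complex.conj_im, coe_re, coe_im,
    ρ_re, ρ_im]
  ring

lemma norm_discCoord_le_of_bounds {u : ℝ} (hu : (τ.re + 1 / 2) ^ 2 = u ^ 2) (hu0 : 0 ≤ u)
    (hu1 : u ≤ 1 / 2) (hcircle : 1 ≤ (1 / 2 - u) ^ 2 + τ.im ^ 2) (him : √3 / 2 ≤ τ.im)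
    (him' : τ.im ≤ 0.957) : ‖discCoord τ‖ ≤ 0.13 := by
  obtain ⟨hsqrt_gt, hsqrt_lt⟩ := sqrt_three_bounds
  have hsqrt_sq : √3 ^ 2 = 3 := Real.sq_sqrt (by norm_num)
  have hu_le : u ≤ 0.21 := by nlinarith
  have hu_sq : u ^ 2 ≤ 0.0441 := by nlinarith
  rw [discCoord, norm_div, div_le_iff₀ (norm_pos_iff.mpr (coe_sub_conj_ρ_ne_zero τ))]
  refine (sq_le_sq₀ (norm_nonneg _) (by positivity)).mp ?_
  rw [mul_pow, sq_norm_coe_sub_ρ, sq_norm_coe_sub_conj_ρ, hu]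
  have him_sq : τ.im ^ 2 ≤ (√3 / 2 + 0.957) * τ.im - 0.957 * (√3 / 2) := by
    linarith [mul_nonneg (sub_nonneg.mpr him) (sub_nonneg.mpr him')]
  have hsqrt_im : 1.73205 * τ.im ≤ √3 * τ.im :=
    mul_le_mul_of_nonneg_right hsqrt_gt.le τ.im_pos.le
  ring_nf at him_sq hsqrt_im ⊢
  linarith

lemma jHat_discCoord_pow_three (τ : ℍ) : jHat (discCoord τ ^ 3) = jInv τ := by
  rw [← jInv_discPoint (discCoord_mem_ball τ), discPoint_discCoord]

lemma exists_jHat_pow_three_eq_of_mem_fd (h : τ ∈ 𝒟) (him' : τ.im ≤ 0.957) :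
    ∃ w : ℂ, ‖w‖ ≤ 0.13 ∧ jHat (w ^ 3) = jInv τ := by
  have him := sqrt_three_div_two_le_im_of_mem_fd h
  have hcircle : 1 ≤ τ.re ^ 2 + τ.im ^ 2 := by
    simpa only [Complex.normSq_apply, coe_re, coe_im, ← sq] using h.1
  obtain ⟨hre_ge, hre_le⟩ := abs_le.mp h.2
  rcases le_total τ.re 0 with hre | hre
  · refine ⟨discCoord τ, norm_discCoord_le_of_bounds (u := τ.re + 1 / 2) rfl (by linarith)
      (by linarith) ?_ him him', jHat_discCoord_pow_three τ⟩
    linarith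
  · refine ⟨discCoord (ModularGroup.T⁻¹ • τ), norm_discCoord_le_of_bounds (u := 1 / 2 - τ.re) ?_
      (by linarith) (by linarith) ?_ ?_ ?_,
      (jHat_discCoord_pow_three _).trans (jInv_smul _ _)⟩
    · rw [ModularGroup.re_T_inv_smul]
      ring
    · rw [ModularGroup.im_T_inv_smul]
      linarith
    · rwa [ModularGroup.im_T_inv_smul]
    · rwa [ModularGroup.im_T_inv_smul]

lemma gOne_one_lt {g : ℂ → ℝ} (hg : gInfty = g ∘ jInv) {ζ : ℂ} (h0 : ζ ≠ 0) (h1 : ζ ≠ 1) :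
    gOne g 1 < gOne g ζ := by
  obtain ⟨τ, rfl⟩ := jInv_surjective ζ
  obtain ⟨γ, hγ⟩ := ModularGroup.exists_smul_mem_fd τ
  rw [← jInv_smul γ] at h0 h1 ⊢
  rcases le_total 0.957 (γ • τ).im with him | him
  · exact gOne_one_lt_of_le_im hg him h0
  · obtain ⟨w, hw, hj⟩ := exists_jHat_pow_three_eq_of_mem_fd hγ him
    rw [← hj] at h0 h1 ⊢
    refine gOne_one_lt_of_norm_le hg ?_ hw h1
    rintro rfl
    simp [jHat] at h0

end Covering

theorem propositionA :
    (∃! g : ℂ → ℝ, gInfty = g ∘ jInv) ∧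
    ∀ gHyp : ℂ → ℝ, gInfty = gHyp ∘ jInv →
      LineDifferentiableAt ℝ gHyp (1 : ℂ) (1 : ℂ) ∧
      0 < lineDeriv ℝ gHyp (1 : ℂ) (1 : ℂ) ∧ lineDeriv ℝ gHyp (1 : ℂ) (1 : ℂ) < 1 ∧
      ∀ ζ : ℂ, ζ ≠ 0 → (IsMinOn (gOne gHyp) {z : ℂ | z ≠ 0} ζ ↔ ζ = 1) := by
  refine ⟨existsUnique_gInfty_eq_comp_jInv, fun gHyp hg ↦ ?_⟩
  have hderiv := hasLineDerivAt_of_eq_comp_jInv hg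
  refine ⟨hderiv.lineDifferentiableAt, hderiv.lineDeriv ▸ slopeAtOne_pos,
    hderiv.lineDeriv ▸ slopeAtOne_le.trans_lt (by norm_num), fun ζ hζ ↦ ⟨fun hmin ↦ ?_, ?_⟩⟩
  · by_contra hne
    exact (gOne_one_lt hg hζ hne).not_ge (hmin one_ne_zero)
  · rintro rfl z hz
    rcases eq_or_ne z 1 with rfl | hne
    · exact le_refl (gOne gHyp 1)
    · exact (gOne_one_lt hg hz hne).le
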